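/- Let $X$ be a (Hausdorff, finite-dimensional) complex manifold with holomorphic tangent bundle $TX$ and projectivized tangent bundle $\pi\colon\mathbb{P}TX\to X$. A continuous function $\varphi\colon X\to\mathbb{R}$ is plurisubharmonic if its composition with every holomorphic map from the unit disc to $X$ is subharmonic. Let $\partial\varphi(v)=\frac12\bigl(d\varphi(v)-i\,d\varphi(iv)\bigr)$, and put $$C(\varphi):=\mathbb{P}TX\setminus\{[v]\in\mathbb{P}TX:\ \varphi\text{ is smooth in a neighbourhood of }\pi[v]\text{ and }\partial\varphi(v)\neq0\},\qquad C(X):=\bigcap_{\varphi}C(\varphi),$$ where $\varphi$ runs over all continuous plurisubharmonic functions on $X$. An exhaustion function is a function $\rho\colon X\to\mathbb{R}$ such that $\{\rho<c\}$ is relatively compact in $X$ for every $c\in\mathbb{R}$, and $X$ is called pseudoconvex if it has a continuous plurisubharmonic exhaustion function $\rho\colon X\to\mathbb{R}^{>0}$. Let $X$ be pseudoconvex, let $\xi$ be a holomorphic vector field on $X$, let $U\subset\mathbb{C}$ be a domain (non-empty, open, connected), and let $\gamma\colon U\to X$ be an integral curve of $\xi$, i.e. $\gamma$ is holomorphic and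 $\gamma'(t)=\xi(\gamma(t))$ for all $t\in U$. Write $\gamma'(U)\subset\mathbb{P}TX$ for the set of all $[\gamma'(t)]$ with $t\in U$ and $\gamma'(t)\neq0$. (1) If $\gamma'(U)$ meets $C(X)$, then $\gamma'$ has no zero on $U$ and $\gamma'(U)\subset C(X)$. (2) If $X$ admits a smooth plurisubharmonic exhaustion function and $\gamma'(U)\subset C(X)$, then $\gamma(U)$ is relatively compact in $X$. In this case, $\gamma$ extends to an integral curve $\mathbb{C}\to X$ of $\xi$; in particular, if $\gamma$ is maximal (it is not the restriction of an integral curve of $\xi$ on a strictly larger domain of $\mathbb{C}$), then $U=\mathbb{C}$. -/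

import Mathlib

open scoped Manifold ContDiff Topology LinearAlgebra.Projectivization

noncomputable section

/-- A continuous function on an open set `V` of the complex plane is subharmonic if it satisfies
the sub-mean value inequality on all sufficiently small circles about every point of `V`. -/
def ContSubharmonicOn (u : ℂ → ℝ) (V : Set ℂ) : Prop :=
  ContinuousOn u V ∧ ∀ z ∈ V, ∀ᶠ r in 𝓝[>] (0 : ℝ), u z ≤ Real.circleAverage u z r

section Manifold

variable (E : Type*) [NormedAddCommGroup E] [NormedSpace ℂ E]
variable {X : Type*} [TopologicalSpace X] [ChartedSpace E X]

/-- Continuous plurisubharmonic functions on the complex manifold `X` (modelled on `E`):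
the composition with every holomorphic map from the unit disc to `X` is subharmonic. -/
def IsContPSH (φ : X → ℝ) : Prop :=
  Continuous φ ∧ ∀ f : ℂ → X, MDifferentiableOn 𝓘(ℂ, ℂ) 𝓘(ℂ, E) f (Metric.ball 0 1) →
    ContSubharmonicOn (φ ∘ f) (Metric.ball 0 1)

/-- An exhaustion function: all its sublevel sets are relatively compact. -/
def IsExhaustion (ρ : X → ℝ) : Prop :=
  ∀ c : ℝ, IsCompact (closure {x | ρ x < c})

variable (X) in
/-- `X` has a continuous plurisubharmonic exhaustion function with positive values. -/
def IsPseudoconvexManifold : Prop :=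
  ∃ ρ : X → ℝ, IsContPSH E ρ ∧ (∀ x, 0 < ρ x) ∧ IsExhaustion ρ

/-- The function `φ` is smooth (in the real sense) on an open neighbourhood of `x`. -/
def IsSmoothAround (φ : X → ℝ) (x : X) : Prop :=
  ∃ V : Set X, IsOpen V ∧ x ∈ V ∧ ContMDiffOn 𝓘(ℝ, E) 𝓘(ℝ, ℝ) ∞ φ V

variable (X) in
/-- `X` has a smooth plurisubharmonic exhaustion function. -/
def HasSmoothPSHExhaustion : Prop :=
  ∃ ρ : X → ℝ, ContMDiff 𝓘(ℝ, E) 𝓘(ℝ, ℝ) ∞ ρ ∧ IsContPSH E ρ ∧ IsExhaustion ρ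

/-- `∂φ(v) = (dφ(v) - i dφ(iv)) / 2`, the value of the `(1,0)`-part of the real differential `dφ`
on the tangent vector `v`. Both tangent spaces are `E`, read in the preferred chart at `x`. -/
def del (φ : X → ℝ) (x : X) (v : TangentSpace 𝓘(ℂ, E) x) : ℂ :=
  let dφ : E →L[ℝ] ℝ := mfderiv 𝓘(ℝ, E) 𝓘(ℝ, ℝ) φ x
  let w : E := v
  ((dφ w : ℂ) - Complex.I * (dφ (Complex.I • w) : ℂ)) / 2

/-- `∂φ` is complex homogeneous, so that its vanishing on a complex line can be tested on any
nonzero vector of the line. -/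
theorem del_smul (φ : X → ℝ) (x : X) (a : ℂ) (v : TangentSpace 𝓘(ℂ, E) x) :
    del E φ x (a • v) = a * del E φ x v := by
  have key : ∀ (L : E →L[ℝ] ℝ) (w : E),
      ((L (a • w) : ℂ) - Complex.I * (L (Complex.I • a • w) : ℂ)) / 2
        = a * (((L w : ℂ) - Complex.I * (L (Complex.I • w) : ℂ)) / 2) := by
    intro L w
    have h1 : a • w = a.re • w + a.im • (Complex.I • w) := by
      conv_lhs => rw [← Complex.re_add_im a]
      rw [add_smul, mul_smul, Complex.coe_smul, Complex.coe_smul]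
    have h2 : Complex.I • a • w = a.re • (Complex.I • w) - a.im • w := by
      rw [h1, smul_add, smul_comm Complex.I a.re w, smul_comm Complex.I a.im (Complex.I • w),
        smul_smul Complex.I Complex.I w, Complex.I_mul_I, neg_one_smul, smul_neg, sub_eq_add_neg]
    rw [h2, h1, map_add, map_sub]
    simp only [map_smul, smul_eq_mul]
    apply Complex.ext <;> simp <;> ring
  exact key _ _

variable (X) in
/-- The (total space of the) projectivized holomorphic tangent bundle of `X`: pairs of a point `x`
and a complex line in the holomorphic tangent space at `x`. -/
abbrev ProjTangent : Type _ :=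
  Σ x : X, ℙ ℂ (TangentSpace 𝓘(ℂ, E) x)

/-- The complement of the set of those `[v]` for which `φ` is smooth around the base point of `v`
and `∂φ(v) ≠ 0`. -/
def criticalSet (φ : X → ℝ) : Set (ProjTangent E X) :=
  {p | IsSmoothAround E φ p.1 ∧ del E φ p.1 p.2.rep ≠ 0}ᶜ

variable (X) in
/-- `C(X)`: the intersection of the sets `criticalSet φ` over all continuous plurisubharmonic
functions `φ` on `X`. -/
def coreSet : Set (ProjTangent E X) :=
  ⋂ (φ : X → ℝ) (_ : IsContPSH E φ), criticalSet E φ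

/-- A holomorphic vector field on `X`: a holomorphic (complex analytic) section of the
holomorphic tangent bundle. -/
def IsHolVectorField [IsManifold 𝓘(ℂ, E) 1 X] (ξ : (x : X) → TangentSpace 𝓘(ℂ, E) x) : Prop :=
  ContMDiff 𝓘(ℂ, E) 𝓘(ℂ, E).tangent ω (fun x => (⟨x, ξ x⟩ : TangentBundle 𝓘(ℂ, E) X))

/-- The complex velocity vector `γ'(t)`. -/
def velocity (γ : ℂ → X) (t : ℂ) : TangentSpace 𝓘(ℂ, E) (γ t) :=
  mfderiv 𝓘(ℂ, ℂ) 𝓘(ℂ, E) γ t (1 : ℂ)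

/-- `γ` restricted to the open set `U` is a holomorphic curve with `γ'(t) = ξ(γ(t))`.
The values of `γ` outside `U` are irrelevant. -/
def IsHolIntegralCurveOn (ξ : (x : X) → TangentSpace 𝓘(ℂ, E) x) (γ : ℂ → X) (U : Set ℂ) : Prop :=
  ∀ t ∈ U, MDifferentiableAt 𝓘(ℂ, ℂ) 𝓘(ℂ, E) γ t ∧ velocity E γ t = ξ (γ t)

/-- The integral curve `γ : U → X` cannot be extended to an integral curve on a larger domain. -/
def IsMaximalHolIntegralCurve (ξ : (x : X) → TangentSpace 𝓘(ℂ, E) x) (γ : ℂ → X)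
    (U : Set ℂ) : Prop :=
  IsHolIntegralCurveOn E ξ γ U ∧
    ∀ (V : Set ℂ) (δ : ℂ → X), IsOpen V → IsConnected V → U ⊆ V →
      IsHolIntegralCurveOn E ξ δ V → Set.EqOn γ δ U → V = U

/-- `γ'(U)` as a subset of the projectivized tangent bundle: all `[γ'(t)]` with `t ∈ U`
and `γ'(t) ≠ 0`. -/
def projVelocity (γ : ℂ → X) (U : Set ℂ) : Set (ProjTangent E X) :=
  {p | ∃ t ∈ U, ∃ h : velocity E γ t ≠ 0, p = ⟨γ t, Projectivization.mk ℂ (velocity E γ t) h⟩}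

end Manifold

end

/-! By `del_velocity_eq_zero_iff`, ∂φ vanishes on γ'(t) exactly when t is a critical point of φ ∘ γ.
So a nonzero γ'(t) spans a line in C(X) iff t is critical for φ ∘ γ for every continuous
plurisubharmonic φ smooth near γ(t).

This condition is carried along by the flow of ξ. For small s the time-s flow Φ_s is holomorphic on
a sublevel set of the exhaustion ρ, so φ ∘ Φ_s is plurisubharmonic there. Taking the maximum with a
steep affine function of ρ gives a global plurisubharmonic ψ that equals φ ∘ Φ_s on a smaller
sublevel set (`exists_isContPSH_eq_comp`). Since ψ(γ(τ)) = φ(γ(τ + s)), criticality passes from t to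
t + s (`exists_ball_isCoreTime_iff`), and connectedness of U gives (1). Zeros of γ' are excluded by
uniqueness: a curve through a zero of ξ is constant.

For (2), a smooth exhaustion ρ is critical all along γ, so ρ ∘ γ is constant and γ(U) lies in a
compact set. If γ is not constant, (1) gives the same for every integral curve on a disc about t₀
that starts at γ(t₀). On the compact set the flow time is bounded below, so such discs can be
enlarged by a fixed amount for ever (`exists_entire_integralCurve`). Uniqueness on U identifies the
entire curve with γ there.

The analytic input is a flow holomorphic in time and initial value (`exists_holomorphic_flow`),
obtained as a uniform limit of Euler polygons. -/

noncomputable section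

universe u w

/-! ### Uniform limits of holomorphic maps -/

section Weierstrass

open Filter Metric

/-- **Weierstrass theorem**: a uniform limit of holomorphic maps between complex normed spaces is
holomorphic, and the derivatives converge uniformly on smaller balls. -/
theorem exists_fderiv_limit_of_tendstoUniformlyOn {G H : Type*}
    [NormedAddCommGroup G] [NormedSpace ℂ G] [NormedAddCommGroup H] [NormedSpace ℂ H]
    [CompleteSpace H] {x : G} {R : ℝ} (hR : 0 < R) {f : ℕ → G → H} {g : G → H}
    (hf : ∀ n, DifferentiableOn ℂ (f n) (ball x R))
    (hfg : TendstoUniformlyOn f g atTop (ball x R)) :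
    ∃ g' : G → G →L[ℂ] H, (∀ y ∈ ball x (R / 2), HasFDerivAt g (g' y) y) ∧
      TendstoUniformlyOn (fun n => fderiv ℂ (f n)) g' atTop (ball x (R / 2)) := by
  have hsub : ∀ y ∈ ball x (R / 2), ball y (R / 2) ⊆ ball x R := fun y hy =>
    ball_subset_ball' (by rw [mem_ball] at hy; linarith)
  have hmem : ball x (R / 2) ⊆ ball x R := ball_subset_ball (by linarith)
  have hC : UniformCauchySeqOn (fun n => fderiv ℂ (f n)) atTop (ball x (R / 2)) := by
    rw [Metric.uniformCauchySeqOn_iff]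
    intro ε hε
    -- The difference of two terms oscillates by at most ε R / 4, and the Cauchy estimate on a disc
    -- of radius R / 2 turns this into ε / 2.
    obtain ⟨N, hN⟩ := Metric.uniformCauchySeqOn_iff.1 hfg.uniformCauchySeqOn (ε * R / 8)
      (by positivity)
    refine ⟨N, fun m hm n hn y hy => ?_⟩
    have hd : ∀ k, DifferentiableAt ℂ (f k) y := fun k =>
      (hf k).differentiableAt (isOpen_ball.mem_nhds (hmem hy))
    rw [dist_eq_norm, ← fderiv_sub (hd m) (hd n)]
    have hb : ∀ z ∈ ball x R, ‖(f m - f n) z‖ ≤ ε * R / 8 := fun z hz => by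
      have := hN m hm n hn z hz
      rw [dist_eq_norm] at this
      exact this.le
    have h1 : ‖fderiv ℂ (f m - f n) y‖ ≤ (ε * R / 4) / (R / 2) := by
      refine Complex.norm_fderiv_le_div_of_mapsTo_ball
        (((hf m).sub (hf n)).mono (hsub y hy)) (fun z hz => ?_) (by positivity)
      rw [mem_closedBall, dist_eq_norm]
      calc _ ≤ ‖(f m - f n) z‖ + ‖(f m - f n) y‖ := norm_sub_le _ _
        _ ≤ ε * R / 8 + ε * R / 8 := add_le_add (hb z (hsub y hy hz)) (hb y (hmem hy))
        _ = ε * R / 4 := by ring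
    have h2 : (ε * R / 4) / (R / 2) = ε / 2 := by field_simp; ring
    linarith
  have hlim : ∀ y, ∃ L : G →L[ℂ] H, y ∈ ball x (R / 2) →
      Tendsto (fun n => fderiv ℂ (f n) y) atTop (𝓝 L) := by
    intro y
    by_cases hy : y ∈ ball x (R / 2)
    · obtain ⟨L, hL⟩ := cauchySeq_tendsto_of_complete (hC.cauchySeq hy)
      exact ⟨L, fun _ => hL⟩
    · exact ⟨0, fun h => absurd h hy⟩
  choose g' hg' using hlim
  have hU := hC.tendstoUniformlyOn_of_tendsto hg'
  refine ⟨g', fun y hy => ?_, hU⟩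
  exact hasFDerivAt_of_tendstoUniformlyOn isOpen_ball hU
    (fun n z hz => ((hf n).differentiableAt (isOpen_ball.mem_nhds (hmem hz))).hasFDerivAt)
    (fun z hz => hfg.tendsto_at (hmem hz)) hy

/-- Uniform limits of smooth maps over `ℂ` are smooth. -/
theorem contDiffAt_of_tendstoUniformlyOn {G : Type u} [NormedAddCommGroup G] [NormedSpace ℂ G]
    {x : G} (k : ℕ) {H : Type u} [NormedAddCommGroup H] [NormedSpace ℂ H]
    [CompleteSpace H] {R : ℝ} (hR : 0 < R) {f : ℕ → G → H} {g : G → H}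
    (hf : ∀ n, ContDiffOn ℂ ∞ (f n) (ball x R))
    (hfg : TendstoUniformlyOn f g atTop (ball x R)) : ContDiffAt ℂ k g x := by
  -- The inductive step passes to derivatives, with values in `G →L[ℂ] H`, and halves the radius.
  -- The common universe of `G` and `H` keeps this new target within the induction.
  induction k generalizing H R with
  | zero =>
    have hc : ContinuousOn g (ball x R) :=
      hfg.continuousOn (Frequently.of_forall fun n => (hf n).continuousOn)
    exact (contDiffOn_zero.2 hc).contDiffAt (ball_mem_nhds x hR)
  | succ k ih =>
    obtain ⟨g', hg', hU⟩ := exists_fderiv_limit_of_tendstoUniformlyOn hR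
      (fun n => (hf n).differentiableOn (by simp)) hfg
    push_cast
    rw [contDiffAt_succ_iff_hasFDerivAt]
    refine ⟨g', ⟨ball x (R / 2), ball_mem_nhds x (by positivity), hg'⟩,
      ih (R := R / 2) (by positivity) (fun n => ?_) hU⟩
    exact ((hf n).fderiv_of_isOpen isOpen_ball (m := ∞) (by simp)).mono
      (ball_subset_ball (by linarith))

end Weierstrass

/-! ### Euler's method and the holomorphic local flow -/

section Euler

open Metric Set Filter

variable {E : Type*} [NormedAddCommGroup E] [NormedSpace ℂ E]

/-- The `k`-th iterate of an Euler step of length `h` for the vector field `v`. -/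
def eulerIterate (v : E → E) (h : ℂ) (k : ℕ) (x : E) : E := (fun y => y + h • v y)^[k] x

theorem eulerIterate_succ (v : E → E) (h : ℂ) (k : ℕ) (x : E) :
    eulerIterate v h (k + 1) x = eulerIterate v h k x + h • v (eulerIterate v h k x) := by
  simp only [eulerIterate, Function.iterate_succ_apply']

@[simp]
theorem eulerIterate_zero (v : E → E) (h : ℂ) (x : E) : eulerIterate v h 0 x = x := rfl

theorem norm_eulerIterate_sub_le {v : E → E} {x₀ x : E} {R M : ℝ} {h : ℂ}
    (hM : ∀ y ∈ ball x₀ R, ‖v y‖ ≤ M) (hM0 : 0 ≤ M) {n : ℕ} (hn : ‖x - x₀‖ + n * (‖h‖ * M) < R) :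
    ∀ k ≤ n, ‖eulerIterate v h k x - x‖ ≤ k * (‖h‖ * M) ∧ eulerIterate v h k x ∈ ball x₀ R := by
  have aux : ∀ k ≤ n, ‖eulerIterate v h k x - x‖ ≤ k * (‖h‖ * M) →
      eulerIterate v h k x ∈ ball x₀ R := by
    intro k hk hle
    rw [mem_ball, dist_eq_norm]
    have : (k : ℝ) * (‖h‖ * M) ≤ n * (‖h‖ * M) := by gcongr
    calc _ = ‖(eulerIterate v h k x - x) + (x - x₀)‖ := by congr 1; abel
      _ ≤ _ := norm_add_le _ _
      _ < R := by linarith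
  intro k
  induction k with
  | zero => exact fun hk => ⟨by simp, aux 0 hk (by simp)⟩
  | succ k ih =>
    intro hk
    obtain ⟨h1, h2⟩ := ih (by omega)
    have h3 : ‖eulerIterate v h (k + 1) x - x‖ ≤ ((k + 1 : ℕ) : ℝ) * (‖h‖ * M) := by
      rw [eulerIterate_succ]
      calc _ = ‖(eulerIterate v h k x - x) + h • v (eulerIterate v h k x)‖ := by congr 1; abel
        _ ≤ ‖eulerIterate v h k x - x‖ + ‖h‖ * ‖v (eulerIterate v h k x)‖ := by
          rw [← norm_smul]; exact norm_add_le _ _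
        _ ≤ k * (‖h‖ * M) + ‖h‖ * M := by
          gcongr
          exact hM _ h2
        _ = _ := by push_cast; ring
    exact ⟨h3, aux _ hk h3⟩

/-- An Euler iterate is a finite composition of maps y ↦ y + h v(y), hence smooth jointly in time
and initial value without any theory of differential equations. The bound on `R` keeps every
intermediate point where `v` is smooth. -/
theorem contDiffOn_eulerIterate {v : E → E} {x₀ : E} {R M r ε : ℝ}
    (hM : ∀ y ∈ ball x₀ R, ‖v y‖ ≤ M) (hM0 : 0 ≤ M) (hv : ContDiffOn ℂ ∞ v (ball x₀ R))
    (hR : r + ε * M ≤ R) (n : ℕ) :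
    ContDiffOn ℂ ∞ (fun p : E × ℂ => eulerIterate v (p.2 / n) n p.1) (ball x₀ r ×ˢ ball 0 ε) := by
  have hmem : ∀ p ∈ ball x₀ r ×ˢ ball (0 : ℂ) ε, ∀ k ≤ n,
      eulerIterate v (p.2 / n) k p.1 ∈ ball x₀ R := by
    rintro ⟨x, s⟩ ⟨hx, hs⟩ k hk
    refine (norm_eulerIterate_sub_le hM hM0 ?_ k hk).2
    rw [mem_ball, dist_eq_norm] at hx
    rw [mem_ball_zero_iff] at hs
    simp only at hx hs ⊢
    have h1 : (n : ℝ) * (‖s / n‖ * M) ≤ ‖s‖ * M := by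
      rcases Nat.eq_zero_or_pos n with rfl | hn
      · simp; positivity
      · have : (0 : ℝ) < n := by exact_mod_cast hn
        rw [norm_div, Complex.norm_natCast]
        apply le_of_eq
        field_simp
    nlinarith
  suffices ∀ k ≤ n, ContDiffOn ℂ ∞ (fun p : E × ℂ => eulerIterate v (p.2 / n) k p.1)
      (ball x₀ r ×ˢ ball 0 ε) from this n le_rfl
  intro k
  induction k with
  | zero => exact fun _ => contDiffOn_fst
  | succ k ih =>
    intro hk
    have ih := ih (by omega)
    simp only [eulerIterate_succ]
    refine ih.add (ContDiffOn.smul ?_ (hv.comp ih fun p hp => hmem p hp k (by omega)))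
    exact contDiffOn_snd.div_const _

/-- The Euler method converges to every solution of the equation, with an explicit rate. -/
theorem norm_eulerIterate_sub_solution_le {v : E → E} {x₀ x : E} {R M K : ℝ}
    (hM : ∀ y ∈ ball x₀ R, ‖v y‖ ≤ M) (hM0 : 0 ≤ M) (hK0 : 0 ≤ K)
    (hK : ∀ y ∈ ball x₀ R, ∀ z ∈ ball x₀ R, ‖v y - v z‖ ≤ K * ‖y - z‖)
    {s : ℂ} (hs : ‖x - x₀‖ + ‖s‖ * M < R) {y : ℝ → E} (hy0 : y 0 = x)
    (hyR : ∀ t ∈ Icc (0 : ℝ) 1, y t ∈ ball x₀ R)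
    (hy : ∀ t ∈ Icc (0 : ℝ) 1, HasDerivWithinAt y (s • v (y t)) (Icc 0 1) t)
    {n : ℕ} (hn : 0 < n) :
    ‖eulerIterate v (s / n) n x - y 1‖ ≤ (K * M * ‖s‖ ^ 2 * Real.exp (‖s‖ * K)) / n := by
  have hn' : (0 : ℝ) < n := by exact_mod_cast hn
  have hmem : ∀ k ≤ n, (k / n : ℝ) ∈ Icc (0 : ℝ) 1 := fun k hk =>
    ⟨by positivity, by rw [div_le_one hn']; exact_mod_cast hk⟩
  have hnorm : ‖s / (n : ℂ)‖ = ‖s‖ / n := by rw [norm_div, Complex.norm_natCast]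
  have heul : ∀ k ≤ n, eulerIterate v (s / n) k x ∈ ball x₀ R := fun k hk => by
    refine (norm_eulerIterate_sub_le hM hM0 (n := n) ?_ k hk).2
    rw [hnorm]
    have : (n : ℝ) * (‖s‖ / n * M) = ‖s‖ * M := by field_simp
    rwa [this]
  have hlip : ∀ a ∈ Icc (0 : ℝ) 1, ∀ b ∈ Icc (0 : ℝ) 1, ‖y b - y a‖ ≤ ‖s‖ * M * ‖b - a‖ :=
    fun a ha b hb => (convex_Icc (0 : ℝ) 1).norm_image_sub_le_of_norm_hasDerivWithin_le hy
      (fun t ht => by rw [norm_smul]; gcongr; exact hM _ (hyR t ht)) ha hb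
  -- Error of one step: in time 1/n the solution moves by at most ‖s‖M/n, so its velocity changes by
  -- at most ‖s‖K · ‖s‖M/n, and the length of the step gives another factor 1/n.
  set δ : ℝ := K * M * ‖s‖ ^ 2 / n ^ 2 with hδ
  have hδ0 : 0 ≤ δ := by positivity
  set Λ : ℝ := 1 + ‖s‖ * K / n with hΛ
  have hΛ1 : 1 ≤ Λ := by rw [hΛ]; linarith [show 0 ≤ ‖s‖ * K / n by positivity]
  have hstep : ∀ k, k + 1 ≤ n →
      ‖y ((k + 1 : ℕ) / n) - y (k / n) - (s / n) • v (y (k / n))‖ ≤ δ := by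
    intro k hk
    have ha := hmem k (by omega)
    have hb := hmem (k + 1) hk
    have hab : ((k + 1 : ℕ) / n : ℝ) - k / n = 1 / n := by push_cast; field_simp; ring
    have hsub : Icc (k / n : ℝ) ((k + 1 : ℕ) / n) ⊆ Icc 0 1 := Icc_subset_Icc ha.1 hb.2
    have hle : (k / n : ℝ) ≤ (k + 1 : ℕ) / n := by gcongr; omega
    -- Mean value inequality for the solution minus its tangent line at the left end of the step.
    have key := (convex_Icc (k / n : ℝ) ((k + 1 : ℕ) / n)).norm_image_sub_le_of_norm_hasDerivWithin_le
      (f := fun t => y t - t • (s • v (y (k / n))))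
      (f' := fun t => s • v (y t) - s • v (y (k / n)))
      (C := ‖s‖ * (K * (‖s‖ * M * (1 / n))))
      (fun t ht => by
        have := ((hy t (hsub ht)).mono hsub).sub
          ((hasDerivWithinAt_id t _).smul_const (s • v (y (k / n))))
        simp only [one_smul] at this
        exact this)
      (fun t ht => by
        rw [← smul_sub, norm_smul]
        gcongr
        refine (hK _ (hyR t (hsub ht)) _ (hyR _ ha)).trans ?_
        gcongr
        refine (hlip _ ha _ (hsub ht)).trans ?_
        gcongr
        rw [Real.norm_eq_abs, abs_of_nonneg (by linarith [ht.1]), ← hab]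
        linarith [ht.2])
      (left_mem_Icc.2 hle) (right_mem_Icc.2 hle)
    have e1 : (y ((k + 1 : ℕ) / n) - ((k + 1 : ℕ) / n : ℝ) • (s • v (y (k / n)))) -
        (y (k / n) - (k / n : ℝ) • (s • v (y (k / n)))) =
        y ((k + 1 : ℕ) / n) - y (k / n) - (s / n) • v (y (k / n)) := by
      have : (s / (n : ℂ)) • v (y (k / n)) = ((1 / n : ℝ)) • (s • v (y (k / n))) := by
        rw [← Complex.coe_smul, smul_smul]
        congr 1
        push_cast; ring
      rw [this, ← hab, sub_smul]
      abel
    rw [e1, Real.norm_eq_abs, hab, abs_of_pos (by positivity)] at key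
    refine key.trans (le_of_eq ?_)
    rw [hδ]
    field_simp
  -- A crude discrete Grönwall bound: it avoids the geometric sum, and since Λ ^ n ≤ exp(‖s‖K) it is
  -- still of order 1/n.
  have hind : ∀ k ≤ n, ‖eulerIterate v (s / n) k x - y (k / n)‖ ≤ k * δ * Λ ^ k := by
    intro k
    induction k with
    | zero => intro _; simp [hy0]
    | succ k ih =>
      intro hk
      have ih := ih (by omega)
      have h1 := hstep k hk
      have h2 := hK _ (heul k (by omega)) _ (hyR _ (hmem k (by omega)))
      rw [eulerIterate_succ]
      set e := eulerIterate v (s / n) k x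
      set a := y (k / n)
      set b := y ((k + 1 : ℕ) / n)
      calc ‖e + (s / n : ℂ) • v e - b‖
          = ‖(e - a) + (s / n : ℂ) • (v e - v a) - (b - a - (s / n : ℂ) • v a)‖ := by
            congr 1; rw [smul_sub]; abel
        _ ≤ ‖e - a‖ + ‖(s / n : ℂ) • (v e - v a)‖ + ‖b - a - (s / n : ℂ) • v a‖ :=
            (norm_sub_le _ _).trans (by gcongr; exact norm_add_le _ _)
        _ ≤ ‖e - a‖ + ‖s‖ / n * (K * ‖e - a‖) + δ := by
            rw [norm_smul, hnorm]
            gcongr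
        _ = Λ * ‖e - a‖ + δ := by rw [hΛ]; ring
        _ ≤ Λ * (k * δ * Λ ^ k) + δ * Λ ^ (k + 1) := by
            gcongr
            exact le_mul_of_one_le_right hδ0 (one_le_pow₀ hΛ1)
        _ = ((k + 1 : ℕ) : ℝ) * δ * Λ ^ (k + 1) := by push_cast; ring
  have hfin := hind n le_rfl
  rw [div_self hn'.ne'] at hfin
  refine hfin.trans ?_
  have hexp : Λ ^ n ≤ Real.exp (‖s‖ * K) := by
    calc Λ ^ n ≤ Real.exp (‖s‖ * K / n) ^ n := by
          gcongr
          rw [hΛ, add_comm]; exact Real.add_one_le_exp _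
      _ = Real.exp (‖s‖ * K) := by
          rw [← Real.exp_nat_mul]; congr 1; field_simp
  calc n * δ * Λ ^ n ≤ n * δ * Real.exp (‖s‖ * K) := by gcongr
    _ = _ := by rw [hδ]; field_simp

/-- Picard-Lindelöf with control on the range of the solution. -/
theorem IsPicardLindelof.exists_solution_mem_closedBall {E : Type*} [NormedAddCommGroup E]
    [NormedSpace ℝ E] [CompleteSpace E] {f : ℝ → E → E} {tmin tmax : ℝ} {t₀ : Icc tmin tmax}
    {x₀ x : E} {a r L K : NNReal} (hf : IsPicardLindelof f t₀ x₀ a r L K)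
    (hx : x ∈ closedBall x₀ r) :
    ∃ y : ℝ → E, y t₀ = x ∧ (∀ t, y t ∈ closedBall x₀ a) ∧
      ∀ t ∈ Icc tmin tmax, HasDerivWithinAt y (f t (y t)) (Icc tmin tmax) t := by
  obtain ⟨α, hα⟩ := ODE.FunSpace.exists_isFixedPt_next hf hx
  refine ⟨α.compProj, by rw [ODE.FunSpace.compProj_val, ← hα, ODE.FunSpace.next_apply₀],
    fun t => α.compProj_mem_closedBall hf.mul_max_le, fun t ht => ?_⟩
  refine (ODE.hasDerivWithinAt_picard_Icc t₀.2 hf.continuousOn_uncurry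
    α.continuous_compProj.continuousOn (fun _ _ => α.compProj_mem_closedBall hf.mul_max_le)
    x ht).congr_of_mem (fun t' ht' => ?_) ht
  nth_rw 1 [← hα]
  rw [ODE.FunSpace.compProj_of_mem ht', ODE.FunSpace.next_apply]

/-- Complex time `s` is encoded as real time 1 for the field `s • v`. The initial offset and the
displacement use a quarter of `R` each, so the solution stays within R / 2 of the centre. -/
theorem exists_solution_mem_ball [CompleteSpace E] {v : E → E} {x₀ x : E} {R M K : ℝ} (hR : 0 < R)
    (hM : ∀ y ∈ ball x₀ R, ‖v y‖ ≤ M) (hM0 : 0 ≤ M) (hK0 : 0 ≤ K)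
    (hK : ∀ y ∈ ball x₀ R, ∀ z ∈ ball x₀ R, ‖v y - v z‖ ≤ K * ‖y - z‖)
    {s : ℂ} (hx : ‖x - x₀‖ ≤ R / 4) (hs : ‖s‖ * M ≤ R / 4) :
    ∃ y : ℝ → E, y 0 = x ∧ (∀ t ∈ Icc (0 : ℝ) 1, y t ∈ ball x₀ R) ∧
      ∀ t ∈ Icc (0 : ℝ) 1, HasDerivWithinAt y (s • v (y t)) (Icc 0 1) t := by
  have hsub : closedBall x₀ (R / 2) ⊆ ball x₀ R := closedBall_subset_ball (by linarith)
  obtain ⟨a, ha⟩ : ∃ a : NNReal, (a : ℝ) = R / 2 := ⟨⟨R / 2, by positivity⟩, rfl⟩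
  obtain ⟨r, hr⟩ : ∃ a : NNReal, (a : ℝ) = R / 4 := ⟨⟨R / 4, by positivity⟩, rfl⟩
  obtain ⟨L, hL⟩ : ∃ a : NNReal, (a : ℝ) = ‖s‖ * M := ⟨⟨‖s‖ * M, by positivity⟩, rfl⟩
  obtain ⟨K', hK'⟩ : ∃ a : NNReal, (a : ℝ) = ‖s‖ * K := ⟨⟨‖s‖ * K, by positivity⟩, rfl⟩
  have hpl : IsPicardLindelof (fun _ : ℝ => fun y => s • v y) (tmin := 0) (tmax := 1)
      ⟨0, by simp⟩ x₀ a r L K' := by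
    refine IsPicardLindelof.of_time_independent (fun y hy => ?_) ?_ ?_
    · rw [norm_smul, hL]
      exact mul_le_mul_of_nonneg_left (hM y (hsub (ha ▸ hy))) (norm_nonneg _)
    · refine LipschitzOnWith.of_dist_le_mul fun y hy z hz => ?_
      rw [dist_eq_norm, dist_eq_norm, ← smul_sub, norm_smul, hK', mul_assoc]
      exact mul_le_mul_of_nonneg_left (hK y (hsub (ha ▸ hy)) z (hsub (ha ▸ hz))) (norm_nonneg _)
    · simp only [sub_zero, sub_self]
      rw [max_eq_left (by norm_num), ha, hr, hL]
      linarith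
  obtain ⟨y, h0, hy, hd⟩ := hpl.exists_solution_mem_closedBall (x := x)
    (by rw [mem_closedBall, dist_eq_norm, hr]; exact hx)
  exact ⟨y, h0, fun t _ => hsub (ha ▸ hy t), hd⟩

/-- Both endpoints are limits of the same Euler sequence, so convergence of the method already
contains uniqueness. -/
theorem solution_endpoint_unique {v : E → E} {x₀ : E} {R M K : ℝ}
    (hM : ∀ y ∈ ball x₀ R, ‖v y‖ ≤ M) (hM0 : 0 ≤ M) (hK0 : 0 ≤ K)
    (hK : ∀ y ∈ ball x₀ R, ∀ z ∈ ball x₀ R, ‖v y - v z‖ ≤ K * ‖y - z‖)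
    {s : ℂ} {y z : ℝ → E} (hs : ‖y 0 - x₀‖ + ‖s‖ * M < R) (hyz : y 0 = z 0)
    (hyR : ∀ t ∈ Icc (0 : ℝ) 1, y t ∈ ball x₀ R) (hzR : ∀ t ∈ Icc (0 : ℝ) 1, z t ∈ ball x₀ R)
    (hy : ∀ t ∈ Icc (0 : ℝ) 1, HasDerivWithinAt y (s • v (y t)) (Icc 0 1) t)
    (hz : ∀ t ∈ Icc (0 : ℝ) 1, HasDerivWithinAt z (s • v (z t)) (Icc 0 1) t) : y 1 = z 1 := by
  have hlim : ∀ w : ℝ → E, w 0 = y 0 → (∀ t ∈ Icc (0 : ℝ) 1, w t ∈ ball x₀ R) →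
      (∀ t ∈ Icc (0 : ℝ) 1, HasDerivWithinAt w (s • v (w t)) (Icc 0 1) t) →
      Tendsto (fun n : ℕ => eulerIterate v (s / n) n (y 0)) atTop (𝓝 (w 1)) := by
    intro w hw0 hwR hw
    rw [tendsto_iff_norm_sub_tendsto_zero]
    refine squeeze_zero' (Eventually.of_forall fun _ => norm_nonneg _)
      ((eventually_gt_atTop 0).mono fun n hn => norm_eulerIterate_sub_solution_le hM hM0 hK0 hK hs
        hw0 hwR hw hn) (tendsto_const_div_atTop_nhds_zero_nat _)
  exact tendsto_nhds_unique (hlim y rfl hyR hy) (hlim z hyz.symm hzR hz)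

theorem exists_ball_bounds {v : E → E} {x₀ : E} (hv : ContDiffAt ℂ ω v x₀) {N : Set E}
    (hN : N ∈ 𝓝 x₀) :
    ∃ R > 0, ∃ M > 0, ∃ K ≥ 0, ball x₀ R ⊆ N ∧ ContDiffOn ℂ ∞ v (ball x₀ R) ∧
      (∀ y ∈ ball x₀ R, ‖v y‖ ≤ M) ∧
      ∀ y ∈ ball x₀ R, ∀ z ∈ ball x₀ R, ‖v y - v z‖ ≤ K * ‖y - z‖ := by
  obtain ⟨u, hu, hvu⟩ := hv.contDiffOn (m := ∞) (by simp) (by simp)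
  obtain ⟨K, t, ht, hKt⟩ := (hv.of_le (m := 1) (by simp)).exists_lipschitzOnWith
  obtain ⟨R, hR, hball⟩ := Metric.mem_nhds_iff.1
    (Filter.inter_mem (Filter.inter_mem hu hN)
      (Filter.inter_mem ht (hv.continuousAt.norm.eventually_lt_const (lt_add_one _))))
  refine ⟨R, hR, ‖v x₀‖ + 1, by positivity, K, K.2, fun y hy => (hball hy).1.2,
    hvu.mono fun y hy => (hball hy).1.1, fun y hy => (hball hy).2.2.le, fun y hy z hz => ?_⟩
  simpa [dist_eq_norm] using hKt.dist_le_mul y (hball hy).2.1 z (hball hz).2.1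

/-- Near every point, a holomorphic vector field has a flow in complex time, which depends
holomorphically on time and initial value. -/
theorem exists_holomorphic_flow {E : Type u} [NormedAddCommGroup E] [NormedSpace ℂ E]
    [CompleteSpace E] {v : E → E} {x₀ : E} (hv : ContDiffAt ℂ ω v x₀) {N : Set E} (hN : N ∈ 𝓝 x₀) :
    ∃ r > 0, ∃ ε > 0, ∃ F : E × ℂ → E,
      ContDiffOn ℂ ∞ F (ball x₀ r ×ˢ ball 0 ε) ∧
      ∀ x ∈ ball x₀ r, F (x, 0) = x ∧ ∀ s ∈ ball (0 : ℂ) ε,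
        F (x, s) ∈ N ∧ HasDerivAt (fun s => F (x, s)) (v (F (x, s))) s := by
  obtain ⟨R, hR, M, hM0, K, hK0, hball, hv', hM, hK⟩ := exists_ball_bounds hv hN
  set r := R / 4
  set ε := R / (4 * M)
  have hr : 0 < r := by positivity
  have hε : 0 < ε := by positivity
  have hεM : ε * M = R / 4 := by simp only [ε]; field_simp
  set Ω : Set (E × ℂ) := ball x₀ r ×ˢ ball 0 ε
  have hΩ : IsOpen Ω := isOpen_ball.prod isOpen_ball
  have hbd : ∀ p ∈ Ω, ‖p.1 - x₀‖ ≤ R / 4 ∧ ‖p.2‖ * M ≤ R / 4 ∧ ‖p.1 - x₀‖ + ‖p.2‖ * M < R := by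
    rintro ⟨x, s⟩ ⟨hx, hs⟩
    rw [mem_ball, dist_eq_norm] at hx
    rw [mem_ball_zero_iff] at hs
    have : ‖s‖ * M ≤ ε * M := by gcongr
    simp only [r] at hx ⊢
    exact ⟨hx.le, by linarith, by linarith⟩
  have hsol : ∀ p : E × ℂ, ∃ y : ℝ → E, p ∈ Ω → y 0 = p.1 ∧
      (∀ t ∈ Icc (0 : ℝ) 1, y t ∈ ball x₀ R) ∧
      ∀ t ∈ Icc (0 : ℝ) 1, HasDerivWithinAt y (p.2 • v (y t)) (Icc 0 1) t := by
    intro p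
    by_cases hp : p ∈ Ω
    · obtain ⟨y, hy⟩ := exists_solution_mem_ball hR hM hM0.le hK0 hK (hbd p hp).1 (hbd p hp).2.1
      exact ⟨y, fun _ => hy⟩
    · exact ⟨0, fun h => absurd h hp⟩
  -- The solutions are chosen point by point, with no regularity in the parameters; holomorphy comes
  -- only from the uniform limit.
  choose Y hY using hsol
  have hunif : TendstoUniformlyOn (fun (n : ℕ) (p : E × ℂ) => eulerIterate v (p.2 / n) n p.1)
      (fun p => Y p 1) atTop Ω := by
    rw [Metric.tendstoUniformlyOn_iff]
    intro δ hδ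
    have hC := (tendsto_const_div_atTop_nhds_zero_nat
      (K * M * ε ^ 2 * Real.exp (ε * K))).eventually_lt_const hδ
    filter_upwards [hC, eventually_gt_atTop 0] with n hn hn0 p hp
    rw [dist_comm, dist_eq_norm]
    refine lt_of_le_of_lt ?_ hn
    refine (norm_eulerIterate_sub_solution_le hM hM0.le hK0 hK (hbd p hp).2.2 (hY p hp).1
      (hY p hp).2.1 (hY p hp).2.2 hn0).trans ?_
    have : ‖p.2‖ ≤ ε := (mem_ball_zero_iff.1 hp.2).le
    gcongr
  have hsmooth : ContDiffOn ℂ ∞ (fun p => Y p 1) Ω := by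
    intro p hp
    obtain ⟨ρ, hρ, hρΩ⟩ := Metric.isOpen_iff.1 hΩ p hp
    refine (contDiffAt_infty.2 fun k => ?_).contDiffWithinAt
    exact contDiffAt_of_tendstoUniformlyOn k hρ
      (fun n => (contDiffOn_eulerIterate hM hM0.le hv'
        (by rw [hεM]; simp only [r]; linarith) n).mono hρΩ) (hunif.mono hρΩ)
  refine ⟨r, hr, ε, hε, fun p => Y p 1, hsmooth, fun x hx => ⟨?_, fun s hs => ?_⟩⟩
  · have hp : ((x, 0) : E × ℂ) ∈ Ω := ⟨hx, mem_ball_self hε⟩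
    -- For `s = 0` the error bound is zero and a single Euler step does not move `x`.
    have := norm_eulerIterate_sub_solution_le hM hM0.le hK0 hK (hbd _ hp).2.2 (hY _ hp).1
      (hY _ hp).2.1 (hY _ hp).2.2 one_pos
    have h2 : ‖x - Y (x, 0) 1‖ ≤ 0 := by simpa [eulerIterate] using this
    exact (sub_eq_zero.1 (norm_le_zero_iff.1 h2)).symm
  · have hmaps : ∀ s ∈ ball (0 : ℂ) ε, ((x, s) : E × ℂ) ∈ Ω := fun s hs => ⟨hx, hs⟩
    have hdiff : DifferentiableOn ℂ (fun s => Y (x, s) 1) (ball 0 ε) :=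
      (hsmooth.differentiableOn (by simp)).comp (g := fun p => Y p 1) (f := fun s : ℂ => (x, s))
        (by fun_prop) hmaps
    have hmem : ∀ s ∈ ball (0 : ℂ) ε, Y (x, s) 1 ∈ ball x₀ R := fun s hs =>
      (hY _ (hmaps s hs)).2.1 1 (by simp)
    refine ⟨hball (hmem s hs), ?_⟩
    have hda : ∀ s ∈ ball (0 : ℂ) ε, DifferentiableAt ℂ (fun s => Y (x, s) 1) s := fun s hs =>
      hdiff.differentiableAt (isOpen_ball.mem_nhds hs)
    -- Running for complex time τs is the same as following the solution for `s` up to real time τ.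
    -- This relates the endpoint map to actual solutions.
    have hray : ∀ s ∈ ball (0 : ℂ) ε, ∀ τ ∈ Icc (0 : ℝ) 1, Y (x, τ • s) 1 = Y (x, s) τ := by
      intro s hs τ hτ
      have hτs : τ • s ∈ ball (0 : ℂ) ε := by
        rw [mem_ball_zero_iff] at hs ⊢
        rw [norm_smul, Real.norm_of_nonneg hτ.1]
        exact (mul_le_of_le_one_left (norm_nonneg _) hτ.2).trans_lt hs
      have h1 := hY _ (hmaps _ hτs)
      have h2 := hY _ (hmaps _ hs)
      have hI : ∀ t ∈ Icc (0 : ℝ) 1, τ * t ∈ Icc (0 : ℝ) 1 := fun t ht =>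
        ⟨mul_nonneg hτ.1 ht.1, mul_le_one₀ hτ.2 ht.1 ht.2⟩
      have := solution_endpoint_unique hM hM0.le hK0 hK (y := Y (x, τ • s))
        (z := fun t => Y (x, s) (τ * t)) (s := τ • s)
        (by rw [h1.1]; exact (hbd _ (hmaps _ hτs)).2.2) (h1.1.trans (by simpa using h2.1.symm)) h1.2.1
        (fun t ht => h2.2.1 _ (hI t ht)) h1.2.2 (fun t ht => ?_)
      · simpa using this
      · have h3 : HasDerivWithinAt (fun t : ℝ => τ * t) τ (Icc 0 1) t := by
          simpa using (hasDerivWithinAt_id t (Icc (0 : ℝ) 1)).const_mul τ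
        have := (h2.2.2 _ (hI t ht)).scomp t h3 hI
        rw [smul_assoc]
        exact this
    -- Differentiate the ray identity at τ = 1, where a one-sided derivative suffices. A complex
    -- derivative is known from a single direction, so `s` cancels when nonzero; continuity of both
    -- sides covers `s = 0`.
    have hmul : ∀ s ∈ ball (0 : ℂ) ε, s • deriv (fun s => Y (x, s) 1) s = s • v (Y (x, s) 1) := by
      intro s hs
      have h1 := (hY _ (hmaps s hs)).2.2 1 (by simp)
      have h2 : HasDerivAt (fun τ : ℝ => τ • s) s 1 := by
        simpa using (hasDerivAt_id (1 : ℝ)).smul_const s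
      have h3 : HasDerivAt (fun s => Y (x, s) 1) (deriv (fun s => Y (x, s) 1) s) ((1 : ℝ) • s) := by
        rw [one_smul]; exact (hda s hs).hasDerivAt
      have h4 := (h3.scomp (1 : ℝ) h2).hasDerivWithinAt (s := Icc 0 1)
      have h5 := h4.congr_of_mem (f₁ := Y (x, s)) (fun τ hτ => (hray s hs τ hτ).symm) (by simp)
      exact (uniqueDiffOn_Icc_zero_one 1 (by simp)).eq_deriv _ h5 h1
    have hne : ∀ s ∈ ball (0 : ℂ) ε, s ≠ 0 →
        deriv (fun s => Y (x, s) 1) s = v (Y (x, s) 1) := fun s hs h0 =>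
      smul_right_injective E h0 (hmul s hs)
    suffices h : deriv (fun s => Y (x, s) 1) s = v (Y (x, s) 1) by
      rw [← h]; exact (hda s hs).hasDerivAt
    by_cases h0 : s = 0
    · subst h0
      have c1 : ContinuousAt (deriv fun s => Y (x, s) 1) 0 :=
        ((hdiff.deriv isOpen_ball).differentiableAt (isOpen_ball.mem_nhds hs)).continuousAt
      have c2 : ContinuousAt (fun s => v (Y (x, s) 1)) 0 :=
        ContinuousAt.comp (g := v) (hv'.continuousOn.continuousAt
          (isOpen_ball.mem_nhds (hmem 0 hs))) (hda 0 hs).continuousAt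
      refine tendsto_nhds_unique (l := 𝓝[≠] (0 : ℂ)) (c1.mono_left nhdsWithin_le_nhds)
        ((c2.mono_left nhdsWithin_le_nhds).congr' ?_)
      filter_upwards [self_mem_nhdsWithin, mem_nhdsWithin_of_mem_nhds (isOpen_ball.mem_nhds hs)]
        with s h1 h2 using (hne s h2 h1).symm
    · exact hne s hs h0

end Euler

/-! ### Holomorphic integral curves and local flows on the manifold -/

section IntegralCurves

open Metric Set Filter

variable {E : Type u} [NormedAddCommGroup E] [NormedSpace ℂ E]
variable {X : Type w} [TopologicalSpace X] [ChartedSpace E X]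

/-- `γ` is holomorphic at `t` with `γ'(t) = ξ(γ(t))`. -/
theorem isHolIntegralCurve_iff_hasMFDerivAt {ξ : (x : X) → TangentSpace 𝓘(ℂ, E) x} {γ : ℂ → X}
    {t : ℂ} :
    (MDifferentiableAt 𝓘(ℂ, ℂ) 𝓘(ℂ, E) γ t ∧ velocity E γ t = ξ (γ t)) ↔
      HasMFDerivAt 𝓘(ℂ, ℂ) 𝓘(ℂ, E) γ t ((1 : ℂ →L[ℂ] ℂ).smulRight (ξ (γ t))) := by
  constructor
  · rintro ⟨h1, h2⟩
    refine h1.hasMFDerivAt.congr_mfderiv ?_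
    apply ContinuousLinearMap.ext_ring
    rw [← h2]
    exact (one_smul ℂ (velocity E γ t)).symm
  · intro h
    refine ⟨h.mdifferentiableAt, ?_⟩
    rw [velocity, h.mfderiv]
    exact one_smul ℂ (ξ (γ t))

theorem IsHolIntegralCurveOn.hasMFDerivAt {ξ : (x : X) → TangentSpace 𝓘(ℂ, E) x} {γ : ℂ → X}
    {U : Set ℂ} (h : IsHolIntegralCurveOn E ξ γ U) {t : ℂ} (ht : t ∈ U) :
    HasMFDerivAt 𝓘(ℂ, ℂ) 𝓘(ℂ, E) γ t ((1 : ℂ →L[ℂ] ℂ).smulRight (ξ (γ t))) :=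
  isHolIntegralCurve_iff_hasMFDerivAt.1 (h t ht)

theorem IsHolIntegralCurveOn.continuousAt {ξ : (x : X) → TangentSpace 𝓘(ℂ, E) x} {γ : ℂ → X}
    {U : Set ℂ} (h : IsHolIntegralCurveOn E ξ γ U) {t : ℂ} (ht : t ∈ U) : ContinuousAt γ t :=
  (h t ht).1.continuousAt

theorem IsHolIntegralCurveOn.mono {ξ : (x : X) → TangentSpace 𝓘(ℂ, E) x} {γ : ℂ → X}
    {U V : Set ℂ} (h : IsHolIntegralCurveOn E ξ γ U) (hVU : V ⊆ U) :
    IsHolIntegralCurveOn E ξ γ V := fun t ht => h t (hVU ht)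

theorem IsHolIntegralCurveOn.congr_of_eventuallyEq {ξ : (x : X) → TangentSpace 𝓘(ℂ, E) x}
    {γ δ : ℂ → X} {U : Set ℂ} (h : IsHolIntegralCurveOn E ξ γ U) {t : ℂ} (ht : t ∈ U)
    (hδ : δ =ᶠ[𝓝 t] γ) : MDifferentiableAt 𝓘(ℂ, ℂ) 𝓘(ℂ, E) δ t ∧ velocity E δ t = ξ (δ t) := by
  rw [isHolIntegralCurve_iff_hasMFDerivAt]
  have h1 := (h.hasMFDerivAt ht).congr_of_eventuallyEq hδ
  have h2 : (show E from ξ (δ t)) = (show E from ξ (γ t)) :=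
    congrArg (fun x => (show E from ξ x)) hδ.eq_of_nhds
  have h3 : (1 : ℂ →L[ℂ] ℂ).smulRight (show E from ξ (δ t)) =
      (1 : ℂ →L[ℂ] ℂ).smulRight (show E from ξ (γ t)) := by rw [h2]
  exact h1.congr_mfderiv h3.symm

theorem IsHolIntegralCurveOn.comp_const_add {ξ : (x : X) → TangentSpace 𝓘(ℂ, E) x}
    {γ : ℂ → X} {U : Set ℂ} (h : IsHolIntegralCurveOn E ξ γ U) (a : ℂ) :
    IsHolIntegralCurveOn E ξ (fun t => γ (a + t)) ((fun t => a + t) ⁻¹' U) := by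
  intro t ht
  rw [isHolIntegralCurve_iff_hasMFDerivAt]
  have h1 : HasMFDerivAt 𝓘(ℂ, ℂ) 𝓘(ℂ, ℂ) (fun t => a + t) t (ContinuousLinearMap.id ℂ ℂ) :=
    ((hasFDerivAt_id t).const_add a).hasMFDerivAt
  exact (HasMFDerivAt.comp t (h.hasMFDerivAt ht) h1).congr_mfderiv
    (ContinuousLinearMap.comp_id _)

/-- Integral curves which agree on overlaps can be glued. -/
theorem exists_glued_integralCurve {ξ : (x : X) → TangentSpace 𝓘(ℂ, E) x} {ι : Type*} [Nonempty ι]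
    {V : ι → Set ℂ} (hV : ∀ i, IsOpen (V i)) {δ : ι → ℂ → X}
    (hδ : ∀ i, IsHolIntegralCurveOn E ξ (δ i) (V i))
    (hag : ∀ i j, EqOn (δ i) (δ j) (V i ∩ V j)) :
    ∃ Γ : ℂ → X, IsHolIntegralCurveOn E ξ Γ (⋃ i, V i) ∧ ∀ i, EqOn Γ (δ i) (V i) := by
  have hex : ∀ t, ∃ x, ∀ i, t ∈ V i → x = δ i t := by
    intro t
    by_cases h : ∃ i, t ∈ V i
    · obtain ⟨i, hi⟩ := h
      exact ⟨δ i t, fun j hj => hag i j ⟨hi, hj⟩⟩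
    · exact ⟨δ (Classical.arbitrary ι) t, fun i hi => absurd ⟨i, hi⟩ h⟩
  choose Γ hΓ using hex
  refine ⟨Γ, fun t ht => ?_, fun i t ht => hΓ t i ht⟩
  obtain ⟨i, hi⟩ := mem_iUnion.1 ht
  refine (hδ i).congr_of_eventuallyEq hi ?_
  filter_upwards [(hV i).mem_nhds hi] with z hz using hΓ z i hz

/-- Near `x₀`, the flow of `ξ` exists for all complex times of modulus less than `ε` and is
holomorphic in the initial value. -/
def HasFlowTime (ξ : (x : X) → TangentSpace 𝓘(ℂ, E) x) (ε : ℝ) (x₀ : X) : Prop :=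
  ∃ W : Set X, IsOpen W ∧ x₀ ∈ W ∧ ∃ Φ : X → ℂ → X, ∀ x ∈ W, Φ x 0 = x ∧
    IsHolIntegralCurveOn E ξ (Φ x) (ball 0 ε) ∧
    ∀ s ∈ ball (0 : ℂ) ε, ContMDiffAt 𝓘(ℂ, E) 𝓘(ℂ, E) ∞ (fun x => Φ x s) x

theorem HasFlowTime.mono {ξ : (x : X) → TangentSpace 𝓘(ℂ, E) x} {ε ε' : ℝ} {x₀ : X}
    (h : HasFlowTime ξ ε x₀) (hε : ε' ≤ ε) : HasFlowTime ξ ε' x₀ := by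
  obtain ⟨W, hW, hx, Φ, hΦ⟩ := h
  exact ⟨W, hW, hx, Φ, fun x hx => ⟨(hΦ x hx).1, (hΦ x hx).2.1.mono (ball_subset_ball hε),
    fun s hs => (hΦ x hx).2.2 s (ball_subset_ball hε hs)⟩⟩

variable [IsManifold 𝓘(ℂ, E) ω X]

/-- The vector field `ξ` read in the preferred chart at `x₀`. -/
def chartField (ξ : (x : X) → TangentSpace 𝓘(ℂ, E) x) (x₀ : X) (y : E) : E :=
  tangentCoordChange 𝓘(ℂ, E) ((extChartAt 𝓘(ℂ, E) x₀).symm y) x₀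
    ((extChartAt 𝓘(ℂ, E) x₀).symm y) (ξ ((extChartAt 𝓘(ℂ, E) x₀).symm y))

theorem contDiffAt_chartField {ξ : (x : X) → TangentSpace 𝓘(ℂ, E) x} (hξ : IsHolVectorField E ξ)
    (x₀ : X) : ContDiffAt ℂ ω (chartField ξ x₀) (extChartAt 𝓘(ℂ, E) x₀ x₀) := by
  have h := hξ x₀
  rw [contMDiffAt_iff] at h
  have h2 := h.2.contDiffAt (by simp)
  exact h2.snd

theorem hasDerivAt_extChartAt_comp {ξ : (x : X) → TangentSpace 𝓘(ℂ, E) x} {γ : ℂ → X} {t : ℂ}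
    (hγ : HasMFDerivAt 𝓘(ℂ, ℂ) 𝓘(ℂ, E) γ t ((1 : ℂ →L[ℂ] ℂ).smulRight (ξ (γ t)))) {x₀ : X}
    (hsrc : γ t ∈ (chartAt E x₀).source) :
    HasDerivAt (extChartAt 𝓘(ℂ, E) x₀ ∘ γ)
      (chartField ξ x₀ (extChartAt 𝓘(ℂ, E) x₀ (γ t))) t := by
  have hm := HasMFDerivAt.comp t (hasMFDerivAt_extChartAt (I := 𝓘(ℂ, E)) hsrc) hγ
  let L : ℂ →L[ℂ] E := (tangentCoordChange 𝓘(ℂ, E) (γ t) x₀ (γ t)).comp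
    ((1 : ℂ →L[ℂ] ℂ).smulRight (show E from ξ (γ t)))
  have hL : HasMFDerivAt 𝓘(ℂ, ℂ) 𝓘(ℂ, E) (extChartAt 𝓘(ℂ, E) x₀ ∘ γ) t L := by
    refine hm.congr_mfderiv ?_
    rw [mfderiv_chartAt_eq_tangentCoordChange hsrc]
    rfl
  have hf : HasFDerivAt (extChartAt 𝓘(ℂ, E) x₀ ∘ γ) L t := hasMFDerivAt_iff_hasFDerivAt.1 hL
  refine hf.hasDerivAt.congr_deriv ?_
  rw [chartField, PartialEquiv.left_inv _ (by rwa [extChartAt_source])]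
  exact congrArg _ (one_smul ℂ (show E from ξ (γ t)))

theorem hasMFDerivAt_extChartAt_symm_comp {ξ : (x : X) → TangentSpace 𝓘(ℂ, E) x} {f : ℂ → E}
    {t : ℂ} {x₀ : X} (hf : HasDerivAt f (chartField ξ x₀ (f t)) t)
    (ht : f t ∈ (extChartAt 𝓘(ℂ, E) x₀).target) :
    HasMFDerivAt 𝓘(ℂ, ℂ) 𝓘(ℂ, E) ((extChartAt 𝓘(ℂ, E) x₀).symm ∘ f) t
      ((1 : ℂ →L[ℂ] ℂ).smulRight (ξ ((extChartAt 𝓘(ℂ, E) x₀).symm (f t)))) := by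
  let xₜ : X := (extChartAt 𝓘(ℂ, E) x₀).symm (f t)
  have h : HasDerivAt f (tangentCoordChange 𝓘(ℂ, E) xₜ x₀ xₜ (ξ xₜ)) t := hf
  have hft1 : xₜ ∈ (extChartAt 𝓘(ℂ, E) x₀).source := (extChartAt 𝓘(ℂ, E) x₀).map_target ht
  have hft2 := mem_extChartAt_source (I := 𝓘(ℂ, E)) xₜ
  -- The manifold derivative at `t` is read in the preferred chart at `xₜ`, not at `x₀`; the two
  -- coordinate changes cancel and leave ξ itself.
  have key : HasDerivAt ((extChartAt 𝓘(ℂ, E) xₜ ∘ (extChartAt 𝓘(ℂ, E) x₀).symm) ∘ f)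
      (ξ xₜ : E) t := by
    have h1 := hasFDerivWithinAt_tangentCoordChange (I := 𝓘(ℂ, E)) ⟨hft1, hft2⟩
    rw [show extChartAt 𝓘(ℂ, E) x₀ xₜ = f t from (extChartAt 𝓘(ℂ, E) x₀).right_inv ht,
      modelWithCornersSelf_coe, range_id, hasFDerivWithinAt_univ] at h1
    refine (h1.comp_hasDerivAt t h).congr_deriv ?_
    exact (tangentCoordChange_comp (v := (show E from ξ xₜ)) ⟨⟨hft2, hft1⟩, hft2⟩).trans
      (tangentCoordChange_self hft2)
  refine ⟨(continuousAt_extChartAt_symm'' ht).comp h.continuousAt, ?_⟩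
  exact (hasFDerivWithinAt_univ.2 key.hasFDerivAt).mono (subset_univ _)

/-- Reduction to real time: on the segment from t to z both curves, read in the chart at `γ t`,
solve the same equation with field multiplied by z - t, so their endpoints agree. -/
theorem IsHolIntegralCurveOn.eventuallyEq {ξ : (x : X) → TangentSpace 𝓘(ℂ, E) x}
    (hξ : IsHolVectorField E ξ) {γ δ : ℂ → X} {U : Set ℂ} (hU : IsOpen U)
    (hγ : IsHolIntegralCurveOn E ξ γ U) (hδ : IsHolIntegralCurveOn E ξ δ U) {t : ℂ} (ht : t ∈ U)
    (heq : γ t = δ t) : γ =ᶠ[𝓝 t] δ := by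
  set ψ := extChartAt 𝓘(ℂ, E) (γ t)
  obtain ⟨R, hR, M, hM0, K, hK0, -, -, hM, hK⟩ :=
    exists_ball_bounds (contDiffAt_chartField hξ (γ t)) univ_mem
  have hloc : ∀ {c : ℂ → X}, IsHolIntegralCurveOn E ξ c U → c t = γ t →
      ∀ᶠ z in 𝓝 t, c z ∈ (chartAt E (γ t)).source ∧ ψ (c z) ∈ ball (ψ (γ t)) R := by
    intro c hc h0
    have h1 := (hc.continuousAt ht).eventually_mem
      ((chartAt E (γ t)).open_source.mem_nhds (by rw [h0]; exact mem_chart_source E (γ t)))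
    have h2 : ContinuousAt (ψ ∘ c) t :=
      ContinuousAt.comp (by rw [h0]; exact continuousAt_extChartAt (γ t)) (hc.continuousAt ht)
    have h3 := h2.eventually_mem (s := ball (ψ (γ t)) R) (by
      rw [Function.comp_apply, h0]; exact ball_mem_nhds _ hR)
    exact h1.and h3
  obtain ⟨η, hη, hball⟩ := Metric.eventually_nhds_iff_ball.1
    (((hloc hγ rfl).and (hloc hδ heq.symm)).and
      ((hU.eventually_mem ht).and (ball_mem_nhds t (ε := R / M) (by positivity))))
  have hsol : ∀ {c : ℂ → X}, IsHolIntegralCurveOn E ξ c U →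
      (∀ z ∈ ball t η, c z ∈ (chartAt E (γ t)).source) → ∀ z ∈ ball t η, ∀ τ ∈ Icc (0 : ℝ) 1,
      HasDerivWithinAt (fun τ : ℝ => ψ (c (t + τ • (z - t))))
        ((z - t) • chartField ξ (γ t) (ψ (c (t + τ • (z - t))))) (Icc 0 1) τ := by
    intro c hc hsrc z hz τ hτ
    have hmem : t + τ • (z - t) ∈ ball t η :=
      (convex_ball t η).add_smul_sub_mem (mem_ball_self hη) hz hτ
    have h1 := hasDerivAt_extChartAt_comp (hc.hasMFDerivAt (hball _ hmem).2.1) (hsrc _ hmem)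
    have h2 : HasDerivAt (fun τ : ℝ => t + τ • (z - t)) (z - t) τ := by
      simpa using ((hasDerivAt_id τ).smul_const (z - t)).const_add t
    exact (h1.scomp τ h2).hasDerivWithinAt
  refine Metric.eventually_nhds_iff_ball.2 ⟨η, hη, fun z hz => ?_⟩
  have hmem : ∀ τ ∈ Icc (0 : ℝ) 1, t + τ • (z - t) ∈ ball t η := fun τ hτ =>
    (convex_ball t η).add_smul_sub_mem (mem_ball_self hη) hz hτ
  have hend := solution_endpoint_unique hM hM0.le hK0 hK (s := z - t)
    (y := fun τ : ℝ => ψ (γ (t + τ • (z - t)))) (z := fun τ : ℝ => ψ (δ (t + τ • (z - t))))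
    (by
      have := (hball z hz).2.2
      rw [dist_eq_norm, lt_div_iff₀ hM0] at this
      simpa [ψ] using this)
    (by simp [heq]) (fun τ hτ => (hball _ (hmem τ hτ)).1.1.2)
    (fun τ hτ => (hball _ (hmem τ hτ)).1.2.2)
    (hsol hγ (fun z hz => (hball z hz).1.1.1) z hz)
    (hsol hδ (fun z hz => (hball z hz).1.2.1) z hz)
  simp only [one_smul, add_sub_cancel] at hend
  exact ψ.injOn (by rw [extChartAt_source]; exact (hball z hz).1.1.1)
    (by rw [extChartAt_source]; exact (hball z hz).1.2.1) hend

/-- Holomorphic integral curves on a connected open set are determined by one value. -/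
theorem IsHolIntegralCurveOn.eqOn [T2Space X] {ξ : (x : X) → TangentSpace 𝓘(ℂ, E) x}
    (hξ : IsHolVectorField E ξ) {γ δ : ℂ → X} {U : Set ℂ} (hU : IsOpen U) (hUc : IsPreconnected U)
    (hγ : IsHolIntegralCurveOn E ξ γ U) (hδ : IsHolIntegralCurveOn E ξ δ U) {t₀ : ℂ} (ht₀ : t₀ ∈ U)
    (heq : γ t₀ = δ t₀) : EqOn γ δ U := by
  set u := {t | γ t = δ t} ∩ U
  suffices h : U ⊆ u from fun t ht => (h ht).1
  refine hUc.subset_of_closure_inter_subset ?_ ⟨t₀, ht₀, heq, ht₀⟩ ?_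
  · rw [isOpen_iff_mem_nhds]
    rintro t ⟨h1, h2⟩
    exact inter_mem (hγ.eventuallyEq hξ hU hδ h2 h1) (hU.mem_nhds h2)
  · rintro t ⟨h1, h2⟩
    have := mem_closure_iff_nhdsWithin_neBot.1 h1
    refine ⟨tendsto_nhds_unique (l := 𝓝[u] t) ((hγ.continuousAt h2).tendsto.mono_left nhdsWithin_le_nhds)
      (((hδ.continuousAt h2).tendsto.mono_left nhdsWithin_le_nhds).congr' ?_), h2⟩
    filter_upwards [self_mem_nhdsWithin] with z hz using hz.1.symm

theorem exists_hasFlowTime [CompleteSpace E] {ξ : (x : X) → TangentSpace 𝓘(ℂ, E) x}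
    (hξ : IsHolVectorField E ξ) (x₀ : X) : ∃ ε > 0, HasFlowTime ξ ε x₀ := by
  set ψ := extChartAt 𝓘(ℂ, E) x₀
  have htgt : IsOpen ψ.target := isOpen_extChartAt_target x₀
  obtain ⟨r, hr, ε, hε, F, hF, hFx⟩ := exists_holomorphic_flow (contDiffAt_chartField hξ x₀)
    (htgt.mem_nhds (mem_extChartAt_target x₀))
  refine ⟨ε, hε, ψ.source ∩ ψ ⁻¹' ball (ψ x₀) r,
    (continuousOn_extChartAt x₀).isOpen_inter_preimage (isOpen_extChartAt_source x₀) isOpen_ball,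
    ⟨mem_extChartAt_source x₀, mem_ball_self hr⟩, fun x s => ψ.symm (F (ψ x, s)), ?_⟩
  rintro x ⟨hxs, hxr⟩
  obtain ⟨h0, hs⟩ := hFx _ hxr
  refine ⟨(congrArg ψ.symm h0).trans (ψ.left_inv hxs), fun s hs' => ?_, fun s hs' => ?_⟩
  · rw [isHolIntegralCurve_iff_hasMFDerivAt]
    exact hasMFDerivAt_extChartAt_symm_comp (f := fun s => F (ψ x, s)) (hs s hs').2 (hs s hs').1
  · have h1 : ContMDiffAt 𝓘(ℂ, E) 𝓘(ℂ, E) ∞ ψ x :=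
      contMDiffAt_extChartAt' (by rwa [extChartAt_source] at hxs)
    have h2 : ContDiffAt ℂ ∞ F (ψ x, s) :=
      hF.contDiffAt ((isOpen_ball.prod isOpen_ball).mem_nhds ⟨hxr, hs'⟩)
    have h3 : ContDiffAt ℂ ∞ (fun y => F (y, s)) (ψ x) :=
      h2.comp (ψ x) (f := fun y => (y, s)) (by fun_prop)
    have h4 : ContMDiffAt 𝓘(ℂ, E) 𝓘(ℂ, E) ∞ ψ.symm (F (ψ x, s)) :=
      (contMDiffOn_extChartAt_symm x₀).contMDiffAt (htgt.mem_nhds (hs s hs').1)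
    exact h4.comp x (h3.contMDiffAt.comp x h1)

/-- Flow times are locally bounded below, and a finite cover allows a minimum. This uniformity
permits continuation by steps of fixed size. -/
theorem IsCompact.exists_hasFlowTime [CompleteSpace E] {ξ : (x : X) → TangentSpace 𝓘(ℂ, E) x}
    (hξ : IsHolVectorField E ξ) {K : Set X} (hK : IsCompact K) :
    ∃ ε > 0, ∀ x ∈ K, HasFlowTime ξ ε x := by
  refine hK.induction_on (p := fun S => ∃ ε > 0, ∀ x ∈ S, HasFlowTime ξ ε x)
    ⟨1, one_pos, by simp⟩ ?_ ?_ ?_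
  · rintro S T hST ⟨ε, hε, h⟩
    exact ⟨ε, hε, fun x hx => h x (hST hx)⟩
  · rintro S T ⟨ε, hε, h⟩ ⟨ε', hε', h'⟩
    refine ⟨min ε ε', lt_min hε hε', ?_⟩
    rintro x (hx | hx)
    · exact (h x hx).mono (min_le_left _ _)
    · exact (h' x hx).mono (min_le_right _ _)
  · intro x _
    obtain ⟨ε, hε, W, hW, hx, Φ, hΦ⟩ := _root_.exists_hasFlowTime hξ x
    exact ⟨W, mem_nhdsWithin_of_mem_nhds (hW.mem_nhds hx), ε, hε, fun y hy => ⟨W, hW, hy, Φ, hΦ⟩⟩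

/-- Local flows fit together to a flow on an open set. -/
theorem exists_flow_of_hasFlowTime [T2Space X] {ξ : (x : X) → TangentSpace 𝓘(ℂ, E) x}
    (hξ : IsHolVectorField E ξ) {Ω : Set X} (hΩ : IsOpen Ω) {ε : ℝ} (hε : 0 < ε)
    (h : ∀ x ∈ Ω, HasFlowTime ξ ε x) :
    ∃ Φ : X → ℂ → X, ∀ x ∈ Ω, Φ x 0 = x ∧ IsHolIntegralCurveOn E ξ (Φ x) (ball 0 ε) ∧
      ∀ s ∈ ball (0 : ℂ) ε, ContMDiffAt 𝓘(ℂ, E) 𝓘(ℂ, E) ∞ (fun x => Φ x s) x := by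
  have hex : ∀ x, ∃ c : ℂ → X, x ∈ Ω → c 0 = x ∧ IsHolIntegralCurveOn E ξ c (ball 0 ε) := by
    intro x
    by_cases hx : x ∈ Ω
    · obtain ⟨W, hW, hxW, Φ, hΦ⟩ := h x hx
      exact ⟨Φ x, fun _ => ⟨(hΦ x hxW).1, (hΦ x hxW).2.1⟩⟩
    · exact ⟨fun _ => x, fun h => absurd h hx⟩
  choose Φ hΦ using hex
  refine ⟨Φ, fun x hx => ⟨(hΦ x hx).1, (hΦ x hx).2, fun s hs => ?_⟩⟩
  -- The curves `Φ x` were chosen independently of each other; uniqueness identifies them near `x`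
  -- with one local flow, which is holomorphic in the initial value.
  obtain ⟨W, hW, hxW, Ψ, hΨ⟩ := h x hx
  refine ((hΨ x hxW).2.2 s hs).congr_of_eventuallyEq ?_
  filter_upwards [hW.mem_nhds hxW, hΩ.mem_nhds hx] with y hyW hyΩ
  exact (hΦ y hyΩ).2.eqOn hξ isOpen_ball (convex_ball 0 ε).isPreconnected (hΨ y hyW).2.1
    (mem_ball_self hε) ((hΦ y hyΩ).1.trans (hΨ y hyW).1.symm) hs

end IntegralCurves

/-! ### The sub-mean value inequality -/

section Subharmonic

open Metric Set Filter Real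

theorem eventually_le_circleAverage_congr {u v : ℂ → ℝ} {z : ℂ} (huv : u =ᶠ[𝓝 z] v)
    (hu : ∀ᶠ r in 𝓝[>] (0 : ℝ), u z ≤ circleAverage u z r) :
    ∀ᶠ r in 𝓝[>] (0 : ℝ), v z ≤ circleAverage v z r := by
  obtain ⟨δ, hδ, hball⟩ := Metric.eventually_nhds_iff_ball.1 huv
  filter_upwards [hu, Ioo_mem_nhdsGT hδ] with r hr hrδ
  rw [← huv.eq_of_nhds, ← circleAverage_congr_sphere (f₁ := u)]
  · exact hr
  · intro w hw
    rw [mem_sphere, abs_of_pos hrδ.1] at hw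
    exact hball w (by rw [mem_ball, hw]; exact hrδ.2)

theorem eventually_circleIntegrable {u : ℂ → ℝ} {z : ℂ} (hu : ∀ᶠ w in 𝓝 z, ContinuousAt u w) :
    ∀ᶠ r in 𝓝[>] (0 : ℝ), CircleIntegrable u z r := by
  obtain ⟨δ, hδ, hball⟩ := Metric.eventually_nhds_iff_ball.1 hu
  filter_upwards [Ioo_mem_nhdsGT hδ] with r hr
  refine ContinuousOn.circleIntegrable hr.1.le fun w hw => ?_
  rw [mem_sphere] at hw
  exact (hball w (by rw [mem_ball, hw]; exact hr.2)).continuousWithinAt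

theorem eventually_le_circleAverage_max {u v : ℂ → ℝ} {z : ℂ}
    (hcu : ∀ᶠ w in 𝓝 z, ContinuousAt u w) (hcv : ∀ᶠ w in 𝓝 z, ContinuousAt v w)
    (hu : ∀ᶠ r in 𝓝[>] (0 : ℝ), u z ≤ circleAverage u z r)
    (hv : ∀ᶠ r in 𝓝[>] (0 : ℝ), v z ≤ circleAverage v z r) :
    ∀ᶠ r in 𝓝[>] (0 : ℝ), max (u z) (v z) ≤ circleAverage (fun w => max (u w) (v w)) z r := by
  filter_upwards [hu, hv, eventually_circleIntegrable hcu, eventually_circleIntegrable hcv,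
    eventually_circleIntegrable ((hcu.and hcv).mono fun w h => h.1.max h.2)] with r h1 h2 h3 h4 h5
  exact max_le (h1.trans (circleAverage_mono h3 h5 fun _ _ => le_max_left _ _))
    (h2.trans (circleAverage_mono h4 h5 fun _ _ => le_max_right _ _))

theorem eventually_le_circleAverage_mul_add_const {u : ℂ → ℝ} {z : ℂ}
    (hcu : ∀ᶠ w in 𝓝 z, ContinuousAt u w)
    (hu : ∀ᶠ r in 𝓝[>] (0 : ℝ), u z ≤ circleAverage u z r) {a : ℝ} (ha : 0 ≤ a) (b : ℝ) :
    ∀ᶠ r in 𝓝[>] (0 : ℝ), a * u z + b ≤ circleAverage (fun w => a * u w + b) z r := by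
  filter_upwards [hu, eventually_circleIntegrable hcu] with r h1 h2
  have h3 : CircleIntegrable (fun w => a * u w) z r := by
    simpa using! h2.const_fun_smul (a := a)
  rw [circleAverage_fun_add h3 (circleIntegrable_const b z r), circleAverage_const]
  have h4 : circleAverage (fun w => a * u w) z r = a * circleAverage u z r :=
    circleAverage_fun_smul (𝕜 := ℝ) (a := a) (f := u)
  rw [h4]
  gcongr

end Subharmonic

/-! ### Plurisubharmonic functions: localization and gluing -/

section Plurisubharmonic

open Metric Set Filter Real

variable {E : Type u} [NormedAddCommGroup E] [NormedSpace ℂ E]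
variable {X : Type w} [TopologicalSpace X] [ChartedSpace E X]

/-- The definition tests only maps on the unit disc; w ↦ z + δw rescales a germ at z to such a map,
and circles of radius r correspond to radius r/δ. -/
theorem IsContPSH.eventually_le_circleAverage {φ : X → ℝ} (hφ : IsContPSH E φ) {g : ℂ → X} {z : ℂ}
    (hg : ∀ᶠ w in 𝓝 z, MDifferentiableAt 𝓘(ℂ, ℂ) 𝓘(ℂ, E) g w) :
    ∀ᶠ r in 𝓝[>] (0 : ℝ), φ (g z) ≤ circleAverage (φ ∘ g) z r := by
  obtain ⟨δ, hδ, hball⟩ := Metric.eventually_nhds_iff_ball.1 hg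
  have h1 := (hφ.2 (fun w => g (z + δ * w)) (fun w hw => by
    have hw' : z + δ * w ∈ ball z δ := by
      rw [mem_ball_zero_iff] at hw
      rw [mem_ball, dist_eq_norm, add_sub_cancel_left, norm_mul, Complex.norm_real,
        Real.norm_of_nonneg hδ.le]
      exact mul_lt_of_lt_one_right hδ hw
    have h2 : MDifferentiableAt 𝓘(ℂ, ℂ) 𝓘(ℂ, ℂ) (fun w : ℂ => z + δ * w) w :=
      DifferentiableAt.mdifferentiableAt (by fun_prop)
    exact (MDifferentiableAt.comp w (hball _ hw') h2).mdifferentiableWithinAt)).2 0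
      (mem_ball_self one_pos)
  have h2 : Tendsto (fun r : ℝ => r / δ) (𝓝[>] 0) (𝓝[>] 0) := by
    refine tendsto_nhdsWithin_iff.2 ⟨?_, ?_⟩
    · have : Tendsto (fun r : ℝ => r / δ) (𝓝 0) (𝓝 (0 / δ)) := tendsto_id.div_const δ
      rw [zero_div] at this
      exact this.mono_left nhdsWithin_le_nhds
    · filter_upwards [self_mem_nhdsWithin] with r hr using div_pos hr hδ
  filter_upwards [h2.eventually h1] with r hr
  simp only [Function.comp_apply, mul_zero, add_zero] at hr
  refine hr.trans (le_of_eq ?_)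
  rw [circleAverage_eq_circleAverage_zero_one, circleAverage_eq_circleAverage_zero_one (c := z)]
  congr 1
  ext w
  have : (δ : ℂ) ≠ 0 := by exact_mod_cast hδ.ne'
  simp only [Function.comp_apply]
  congr 2
  push_cast
  field_simp
  ring

/-- Plurisubharmonicity can be tested by the sub-mean value inequality along germs of holomorphic
curves. -/
theorem isContPSH_of_local {ψ : X → ℝ} (hψ : Continuous ψ)
    (h : ∀ f : ℂ → X, ∀ z, (∀ᶠ w in 𝓝 z, MDifferentiableAt 𝓘(ℂ, ℂ) 𝓘(ℂ, E) f w) →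
      ∀ᶠ r in 𝓝[>] (0 : ℝ), ψ (f z) ≤ circleAverage (ψ ∘ f) z r) : IsContPSH E ψ := by
  refine ⟨hψ, fun f hf => ⟨hψ.comp_continuousOn hf.continuousOn, fun z hz => h f z ?_⟩⟩
  filter_upwards [isOpen_ball.mem_nhds hz] with w hw
  exact hf.mdifferentiableAt (isOpen_ball.mem_nhds hw)

/-- Transport of a plurisubharmonic function `φ` by a holomorphic map `Φ` defined on a sublevel set
of a plurisubharmonic exhaustion function, glued to a multiple of the exhaustion. -/
theorem exists_isContPSH_eq_comp {φ ρ : X → ℝ} (hφ : IsContPSH E φ) (hρ : IsContPSH E ρ)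
    (hρe : IsExhaustion ρ) (c : ℝ) {Φ : X → X}
    (hΦ : ∀ x, ρ x < c + 2 → MDifferentiableAt 𝓘(ℂ, E) 𝓘(ℂ, E) Φ x) :
    ∃ ψ : X → ℝ, IsContPSH E ψ ∧ ∀ x, ρ x < c → ψ x = φ (Φ x) := by
  have hcont : ∀ x, ρ x < c + 2 → ContinuousAt (φ ∘ Φ) x := fun x hx =>
    hφ.1.continuousAt.comp (hΦ x hx).continuousAt
  have hopen : ∀ a, IsOpen {x | ρ x < a} := fun a => isOpen_lt hρ.1 continuous_const
  obtain ⟨M, hM0, hM⟩ : ∃ M : ℝ, 0 ≤ M ∧ ∀ x, ρ x ≤ c + 1 → |φ (Φ x)| ≤ M := by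
    have hK : IsCompact {x | ρ x ≤ c + 1} :=
      (hρe (c + 2)).of_isClosed_subset (isClosed_le hρ.1 continuous_const)
        (fun x hx => subset_closure (show ρ x < c + 2 by
          have : ρ x ≤ c + 1 := hx
          linarith))
    obtain ⟨M, hM⟩ := hK.exists_bound_of_continuousOn (f := φ ∘ Φ)
      (fun x hx => (hcont x (by have : ρ x ≤ c + 1 := hx
                                linarith)).continuousWithinAt)
    exact ⟨max M 0, le_max_right _ _, fun x hx => (hM x hx).trans (le_max_left _ _)⟩
  -- This function of ρ is -M - 1 on {ρ = c} and M + 1 on {ρ = c + 1}. With |φ ∘ Φ| ≤ M, it lies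
  -- below φ ∘ Φ on {ρ < c} and above it on the seam.
  set b : X → ℝ := fun x => (2 * M + 2) * ρ x + (-(2 * M + 2) * c - M - 1) with hb
  have hbc : Continuous b := (continuous_const.mul hρ.1).add continuous_const
  set ψ : X → ℝ := fun x => if ρ x < c + 1 then max (φ (Φ x)) (b x) else b x with hψ
  have hin : ∀ x, ρ x < c + 1 → ψ =ᶠ[𝓝 x] fun y => max (φ (Φ y)) (b y) := fun x hx => by
    filter_upwards [(hopen _).mem_nhds hx] with y hy
    exact if_pos hy
  -- On the seam {ρ = c + 1} the inequality is strict, so by continuity the maximum is already `b`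
  -- on the inner side.
  have hout : ∀ x, c + 1 ≤ ρ x → ψ =ᶠ[𝓝 x] b := fun x hx => by
    rcases hx.eq_or_lt with h | h
    · have h1 : φ (Φ x) < b x := by
        have := (abs_le.1 (hM x h.ge)).2
        simp only [hb]
        nlinarith
      have h2 := (hcont x (by linarith)).eventually_lt hbc.continuousAt h1
      filter_upwards [h2] with y hy
      simp only [hψ]
      split_ifs
      · exact max_eq_right hy.le
      · rfl
    · filter_upwards [(isOpen_lt continuous_const hρ.1).mem_nhds h] with y hy
      exact if_neg (not_lt.2 (le_of_lt hy))
  have hψc : Continuous ψ := by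
    rw [continuous_iff_continuousAt]
    intro x
    rcases lt_or_ge (ρ x) (c + 1) with h | h
    · have h1 : ContinuousAt (fun y => max (φ (Φ y)) (b y)) x :=
        (hcont x (by linarith)).max hbc.continuousAt
      exact h1.congr_of_eventuallyEq (hin x h)
    · exact hbc.continuousAt.congr_of_eventuallyEq (hout x h)
  refine ⟨ψ, isContPSH_of_local hψc fun f z hf => ?_, fun x hx => ?_⟩
  · have hfz : ContinuousAt f z := hf.self_of_nhds.continuousAt
    have hbs : ∀ᶠ r in 𝓝[>] (0 : ℝ), b (f z) ≤ circleAverage (b ∘ f) z r :=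
      eventually_le_circleAverage_mul_add_const (u := ρ ∘ f)
        (hf.mono fun w hw => hρ.1.continuousAt.comp hw.continuousAt)
        (hρ.eventually_le_circleAverage hf) (by positivity) _
    rcases lt_or_ge (ρ (f z)) (c + 1) with h | h
    · have hev : ∀ᶠ w in 𝓝 z, ρ (f w) < c + 2 :=
        hfz.eventually_mem ((hopen (c + 2)).mem_nhds (show ρ (f z) < c + 2 by linarith))
      have hΦf : ∀ᶠ w in 𝓝 z, MDifferentiableAt 𝓘(ℂ, ℂ) 𝓘(ℂ, E) (Φ ∘ f) w := by
        filter_upwards [hf, hev] with w h1 h2 using (hΦ _ h2).comp w h1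
      refine eventually_le_circleAverage_congr ((hin _ h).comp_tendsto hfz.tendsto).symm ?_
      exact eventually_le_circleAverage_max
        (hΦf.mono fun w hw => hφ.1.continuousAt.comp hw.continuousAt)
        (hf.mono fun w hw => hbc.continuousAt.comp hw.continuousAt)
        (hφ.eventually_le_circleAverage hΦf) hbs
    · exact eventually_le_circleAverage_congr ((hout _ h).comp_tendsto hfz.tendsto).symm hbs
  · have h1 := (abs_le.1 (hM x (by linarith))).1
    have h2 : b x ≤ φ (Φ x) := by
      simp only [hb]
      nlinarith
    simp only [hψ]
    rw [if_pos (by linarith), max_eq_left h2]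

end Plurisubharmonic

/-! ### The core in terms of critical points along curves -/

section Core

open Metric Set Filter

variable {E : Type u} [NormedAddCommGroup E] [NormedSpace ℂ E]
variable {X : Type w} [TopologicalSpace X] [ChartedSpace E X]

theorem ContMDiffAt.real_of_complex {Φ : X → X} {x : X} {n : WithTop ℕ∞}
    (h : ContMDiffAt 𝓘(ℂ, E) 𝓘(ℂ, E) n Φ x) : ContMDiffAt 𝓘(ℝ, E) 𝓘(ℝ, E) n Φ x := by
  rw [contMDiffAt_iff] at h ⊢
  exact ⟨h.1, h.2.restrict_scalars ℝ⟩

theorem HasMFDerivAt.real_of_complex {γ : ℂ → X} {t : ℂ} {L : ℂ →L[ℂ] E}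
    (h : HasMFDerivAt 𝓘(ℂ, ℂ) 𝓘(ℂ, E) γ t L) :
    HasMFDerivAt 𝓘(ℝ, ℂ) 𝓘(ℝ, E) γ t (L.restrictScalars ℝ) :=
  ⟨h.1, HasFDerivWithinAt.restrictScalars ℝ h.2⟩

theorem IsSmoothAround.mdifferentiableAt {φ : X → ℝ} {x : X} (h : IsSmoothAround E φ x) :
    MDifferentiableAt 𝓘(ℝ, E) 𝓘(ℝ, ℝ) φ x := by
  obtain ⟨V, hV, hx, h⟩ := h
  exact (h.contMDiffAt (hV.mem_nhds hx)).mdifferentiableAt (by simp)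

theorem hasFDerivAt_comp_curve {φ : X → ℝ} {γ : ℂ → X} {t : ℂ}
    (hφ : MDifferentiableAt 𝓘(ℝ, E) 𝓘(ℝ, ℝ) φ (γ t))
    (hγ : MDifferentiableAt 𝓘(ℂ, ℂ) 𝓘(ℂ, E) γ t) :
    HasFDerivAt (φ ∘ γ) ((show E →L[ℝ] ℝ from mfderiv 𝓘(ℝ, E) 𝓘(ℝ, ℝ) φ (γ t)).comp
      ((show ℂ →L[ℂ] E from mfderiv 𝓘(ℂ, ℂ) 𝓘(ℂ, E) γ t).restrictScalars ℝ)) t :=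
  hasMFDerivAt_iff_hasFDerivAt.1
    (HasMFDerivAt.comp t hφ.hasMFDerivAt hγ.hasMFDerivAt.real_of_complex)

/-- `∂φ` vanishes on the velocity of a holomorphic curve iff `φ ∘ γ` is critical. -/
theorem del_velocity_eq_zero_iff {φ : X → ℝ} {γ : ℂ → X} {t : ℂ}
    (hφ : MDifferentiableAt 𝓘(ℝ, E) 𝓘(ℝ, ℝ) φ (γ t))
    (hγ : MDifferentiableAt 𝓘(ℂ, ℂ) 𝓘(ℂ, E) γ t) :
    del E φ (γ t) (velocity E γ t) = 0 ↔ fderiv ℝ (φ ∘ γ) t = 0 := by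
  rw [(hasFDerivAt_comp_curve hφ hγ).fderiv]
  set D : E →L[ℝ] ℝ := mfderiv 𝓘(ℝ, E) 𝓘(ℝ, ℝ) φ (γ t) with hD
  set G : ℂ →L[ℂ] E := mfderiv 𝓘(ℂ, ℂ) 𝓘(ℂ, E) γ t with hG
  have e1 : del E φ (γ t) (velocity E γ t) =
      ((D (G 1) : ℂ) - Complex.I * (D (Complex.I • G 1) : ℂ)) / 2 := rfl
  have e2 : ∀ z : ℂ, D (G z) = z.re * D (G 1) + z.im * D (Complex.I • G 1) := by
    intro z
    have : G z = z.re • G 1 + z.im • (Complex.I • G 1) := by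
      conv_lhs => rw [← mul_one z, ← smul_eq_mul, map_smul, ← Complex.re_add_im z]
      rw [add_smul, mul_smul, Complex.coe_smul, Complex.coe_smul]
    rw [this, map_add, map_smul, map_smul, smul_eq_mul, smul_eq_mul]
  rw [e1]
  constructor
  · intro h
    have h1 : D (G 1) = 0 := by simpa using congrArg Complex.re h
    have h2 : D (Complex.I • G 1) = 0 := by simpa using congrArg Complex.im h
    refine ContinuousLinearMap.ext fun z => (e2 z).trans ?_
    rw [h1, h2, mul_zero, mul_zero, add_zero]
    rfl
  · intro h
    have h1 : D (G 1) = 0 := congrArg (fun L : ℂ →L[ℝ] ℝ => L 1) h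
    have h2 : D (G Complex.I) = 0 := congrArg (fun L : ℂ →L[ℝ] ℝ => L Complex.I) h
    rw [e2] at h2
    simp only [Complex.I_re, Complex.I_im, zero_mul, one_mul, zero_add] at h2
    simp [h1, h2]

/-- The chosen representative of the line is a nonzero multiple of the velocity, and ∂φ is
homogeneous, so its vanishing can be tested on the velocity. -/
theorem mk_velocity_mem_coreSet_iff {γ : ℂ → X} {t : ℂ}
    (hγ : MDifferentiableAt 𝓘(ℂ, ℂ) 𝓘(ℂ, E) γ t) (h : velocity E γ t ≠ 0) :
    (⟨γ t, Projectivization.mk ℂ (velocity E γ t) h⟩ : ProjTangent E X) ∈ coreSet E X ↔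
      ∀ φ : X → ℝ, IsContPSH E φ → IsSmoothAround E φ (γ t) → fderiv ℝ (φ ∘ γ) t = 0 := by
  obtain ⟨a, ha⟩ := Projectivization.exists_smul_eq_mk_rep ℂ (velocity E γ t) h
  simp only [coreSet, mem_iInter, criticalSet, mem_compl_iff, mem_ofPred_eq, not_and, not_not]
  refine forall₃_congr fun φ _ hs => ?_
  rw [← ha, ← del_velocity_eq_zero_iff hs.mdifferentiableAt hγ]
  change del E φ (γ t) ((a : ℂ) • velocity E γ t) = 0 ↔ _
  rw [del_smul, mul_eq_zero, or_iff_right a.ne_zero]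

end Core

/-! ### Invariance of the core under the flow, and continuation of curves -/

section CoreFlow

open Metric Set Filter

variable {E : Type u} [NormedAddCommGroup E] [NormedSpace ℂ E]
variable {X : Type w} [TopologicalSpace X] [ChartedSpace E X]

variable (E) in
/-- `t` is a critical point of `φ ∘ γ` for every plurisubharmonic `φ` which is smooth near `γ t`. -/
def IsCoreTime (γ : ℂ → X) (t : ℂ) : Prop :=
  ∀ φ : X → ℝ, IsContPSH E φ → IsSmoothAround E φ (γ t) → fderiv ℝ (φ ∘ γ) t = 0

theorem isHolIntegralCurveOn_const {ξ : (x : X) → TangentSpace 𝓘(ℂ, E) x} {x₀ : X}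
    (h : ξ x₀ = 0) (U : Set ℂ) : IsHolIntegralCurveOn E ξ (fun _ => x₀) U := by
  intro t _
  refine ⟨mdifferentiableAt_const, ?_⟩
  rw [velocity, mfderiv_const, h]
  rfl

theorem IsHolIntegralCurveOn.const_of_fderiv_comp_eq_zero {ξ : (x : X) → TangentSpace 𝓘(ℂ, E) x}
    {γ : ℂ → X} {U : Set ℂ} (hU : IsOpen U) (hUc : IsPreconnected U)
    (hγ : IsHolIntegralCurveOn E ξ γ U) {ρ : X → ℝ} (hρ : ContMDiff 𝓘(ℝ, E) 𝓘(ℝ, ℝ) ∞ ρ)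
    (hcrit : ∀ t ∈ U, fderiv ℝ (ρ ∘ γ) t = 0) {t t' : ℂ} (ht : t ∈ U) (ht' : t' ∈ U) :
    ρ (γ t) = ρ (γ t') :=
  hU.is_const_of_fderiv_eq_zero (𝕜 := ℝ) (f := ρ ∘ γ) hUc
    (fun z hz => (hasFDerivAt_comp_curve ((hρ (γ z)).mdifferentiableAt (by simp))
      (hγ z hz).1).differentiableAt.differentiableWithinAt) hcrit ht ht'

theorem HasFlowTime.exists_integralCurve {ξ : (x : X) → TangentSpace 𝓘(ℂ, E) x} {ε : ℝ} {x : X}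
    (h : HasFlowTime ξ ε x) (a : ℂ) :
    ∃ δ : ℂ → X, δ a = x ∧ IsHolIntegralCurveOn E ξ δ (ball a ε) := by
  obtain ⟨W, -, hx, Φ, hΦ⟩ := h
  refine ⟨fun t => Φ x (-a + t), by simpa using (hΦ x hx).1,
    ((hΦ x hx).2.1.comp_const_add (-a)).mono fun t ht => ?_⟩
  rw [mem_ball, dist_eq_norm] at ht
  rw [mem_preimage, mem_ball_zero_iff, neg_add_eq_sub]
  exact ht

variable [IsManifold 𝓘(ℂ, E) ω X]

/-- The flow for time t' - t pulls a test function smooth near γ(t') back to one smooth near γ(t).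
The symmetry in `t` and `t'` makes the set of core times both open and closed. -/
theorem exists_ball_isCoreTime_iff [CompleteSpace E] [T2Space X]
    {ξ : (x : X) → TangentSpace 𝓘(ℂ, E) x} (hξ : IsHolVectorField E ξ) {ρ : X → ℝ}
    (hρ : IsContPSH E ρ) (hρe : IsExhaustion ρ) {γ : ℂ → X} {U : Set ℂ} (hU : IsOpen U)
    (hγ : IsHolIntegralCurveOn E ξ γ U) {t₀ : ℂ} (ht₀ : t₀ ∈ U) :
    ∃ η > 0, ∀ t ∈ ball t₀ η, ∀ t' ∈ ball t₀ η, IsCoreTime E γ t → IsCoreTime E γ t' := by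
  -- The added 1 keeps γ inside {ρ < c} near `t₀`; the collar up to c + 2 is where the gluing takes
  -- place.
  set c := ρ (γ t₀) + 1
  have hopen : ∀ a, IsOpen {x | ρ x < a} := fun a => isOpen_lt hρ.1 continuous_const
  obtain ⟨ε, hε, hflow⟩ := (hρe (c + 2)).exists_hasFlowTime hξ
  obtain ⟨Φ, hΦ⟩ := exists_flow_of_hasFlowTime hξ (hopen (c + 2)) hε
    fun x hx => hflow x (subset_closure hx)
  obtain ⟨η₁, hη₁, hU₁⟩ := Metric.isOpen_iff.1 hU t₀ ht₀
  have hnear : ∀ᶠ t in 𝓝 t₀, ρ (γ t) < c :=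
    (hγ.continuousAt ht₀).eventually_mem ((hopen c).mem_nhds (lt_add_one (ρ (γ t₀))))
  obtain ⟨η₂, hη₂, hball₂⟩ := Metric.eventually_nhds_iff_ball.1 hnear
  -- With |τ - t₀| < η and |s| < 2η, the bound 3η ≤ η₁ keeps τ + s in `U`, 2η ≤ ε makes the flow
  -- available, and η ≤ η₂ keeps γ in {ρ < c}.
  set η := min (min (η₁ / 3) (ε / 2)) η₂
  have hη : 0 < η := by positivity
  have hle₁ : 3 * η ≤ η₁ := by
    have : η ≤ η₁ / 3 := (min_le_left _ _).trans (min_le_left _ _)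
    linarith
  have hle₂ : 2 * η ≤ ε := by
    have : η ≤ ε / 2 := (min_le_left _ _).trans (min_le_right _ _)
    linarith
  have hlt : ∀ t ∈ ball t₀ η, ρ (γ t) < c := fun t ht =>
    hball₂ t (ball_subset_ball (min_le_right _ _) ht)
  refine ⟨η, hη, fun t ht t' ht' hcore φ hφ hsm => ?_⟩
  set s := t' - t with hs
  have hs2 : s ∈ ball (0 : ℂ) (2 * η) := by
    rw [mem_ball_zero_iff, hs, ← dist_eq_norm]
    rw [mem_ball] at ht ht'
    linarith [dist_triangle_right t' t t₀]
  have hsε : s ∈ ball (0 : ℂ) ε := ball_subset_ball hle₂ hs2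
  have hshift : ∀ τ ∈ ball t₀ η, Φ (γ τ) s = γ (τ + s) := by
    intro τ hτ
    have hx : ρ (γ τ) < c + 2 := by linarith [hlt τ hτ]
    have h1 := (hΦ _ hx).2.1.mono (ball_subset_ball hle₂)
    have h2 : IsHolIntegralCurveOn E ξ (fun σ => γ (τ + σ)) (ball 0 (2 * η)) := by
      refine (hγ.comp_const_add τ).mono fun σ hσ => hU₁ ?_
      rw [mem_ball_zero_iff] at hσ
      rw [mem_ball, dist_eq_norm] at hτ ⊢
      calc ‖τ + σ - t₀‖ = ‖(τ - t₀) + σ‖ := by congr 1; ring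
        _ ≤ ‖τ - t₀‖ + ‖σ‖ := norm_add_le _ _
        _ < η₁ := by linarith
    exact h1.eqOn hξ isOpen_ball (convex_ball _ _).isPreconnected h2
      (mem_ball_self (by positivity)) (by rw [(hΦ _ hx).1, add_zero]) hs2
  obtain ⟨ψ, hψ, hψeq⟩ := exists_isContPSH_eq_comp hφ hρ hρe c (Φ := fun x => Φ x s)
    fun x hx => ((hΦ x hx).2.2 s hsε).mdifferentiableAt (by simp)
  have hts : t + s = t' := by rw [hs]; ring
  have hψsm : IsSmoothAround E ψ (γ t) := by
    obtain ⟨V, hV, hxV, hφV⟩ := hsm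
    have hΦr : ContMDiffOn 𝓘(ℝ, E) 𝓘(ℝ, E) ∞ (fun x => Φ x s) {x | ρ x < c} := fun x hx =>
      (((hΦ x (show ρ x < c + 2 by
        have : ρ x < c := hx
        linarith)).2.2 s hsε).real_of_complex).contMDiffWithinAt
    refine ⟨{x | ρ x < c} ∩ (fun x => Φ x s) ⁻¹' V,
      hΦr.continuousOn.isOpen_inter_preimage (hopen c) hV, ⟨hlt t ht, ?_⟩, ?_⟩
    · rw [mem_preimage, hshift t ht, hts]
      exact hxV
    · exact (hφV.comp (hΦr.mono inter_subset_left) inter_subset_right).congr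
        fun x hx => hψeq x hx.1
  have h0 := hcore ψ hψ hψsm
  have hev : ψ ∘ γ =ᶠ[𝓝 t] fun τ => (φ ∘ γ) (τ + s) := by
    filter_upwards [isOpen_ball.mem_nhds ht] with τ hτ
    rw [Function.comp_apply, hψeq _ (hlt τ hτ), hshift τ hτ, Function.comp_apply]
  rw [hev.fderiv_eq, fderiv_comp_add_right, hts] at h0
  exact h0

/-- Along an integral curve, being in the core is independent of the time. -/
theorem IsHolIntegralCurveOn.isCoreTime_of_isCoreTime [CompleteSpace E] [T2Space X]
    (hX : IsPseudoconvexManifold E X) {ξ : (x : X) → TangentSpace 𝓘(ℂ, E) x}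
    (hξ : IsHolVectorField E ξ) {γ : ℂ → X} {U : Set ℂ} (hU : IsOpen U) (hUc : IsPreconnected U)
    (hγ : IsHolIntegralCurveOn E ξ γ U) {t₀ : ℂ} (ht₀ : t₀ ∈ U) (h : IsCoreTime E γ t₀) :
    ∀ t ∈ U, IsCoreTime E γ t := by
  obtain ⟨ρ, hρ, -, hρe⟩ := hX
  set u := {t | IsCoreTime E γ t} ∩ U
  suffices h : U ⊆ u from fun t ht => (h ht).1
  refine hUc.subset_of_closure_inter_subset ?_ ⟨t₀, ht₀, h, ht₀⟩ ?_
  · rw [isOpen_iff_mem_nhds]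
    rintro t ⟨h1, h2⟩
    obtain ⟨η, hη, hiff⟩ := exists_ball_isCoreTime_iff hξ hρ hρe hU hγ h2
    filter_upwards [hU.mem_nhds h2, ball_mem_nhds t hη] with z hz hzb
    exact ⟨hiff t (mem_ball_self hη) z hzb h1, hz⟩
  · rintro t ⟨h1, h2⟩
    obtain ⟨η, hη, hiff⟩ := exists_ball_isCoreTime_iff hξ hρ hρe hU hγ h2
    obtain ⟨z, hz, hzt⟩ := Metric.mem_closure_iff.1 h1 η hη
    exact ⟨hiff z (by rwa [mem_ball, dist_comm]) t (mem_ball_self hη) hz.1, h2⟩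

/-- An integral curve through a zero of the vector field is constant. -/
theorem IsHolIntegralCurveOn.eqOn_const [T2Space X] {ξ : (x : X) → TangentSpace 𝓘(ℂ, E) x}
    (hξ : IsHolVectorField E ξ) {γ : ℂ → X} {U : Set ℂ} (hU : IsOpen U) (hUc : IsPreconnected U)
    (hγ : IsHolIntegralCurveOn E ξ γ U) {t₀ : ℂ} (ht₀ : t₀ ∈ U) (h : velocity E γ t₀ = 0) :
    EqOn γ (fun _ => γ t₀) U :=
  hγ.eqOn hξ hU hUc (isHolIntegralCurveOn_const ((hγ t₀ ht₀).2.symm.trans h) U) ht₀ rfl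

/-- A zero of the velocity at one time makes the curve constant, and its single value is then a zero
of ξ. -/
theorem IsHolIntegralCurveOn.velocity_ne_zero [T2Space X] {ξ : (x : X) → TangentSpace 𝓘(ℂ, E) x}
    (hξ : IsHolVectorField E ξ) {γ : ℂ → X} {U : Set ℂ} (hU : IsOpen U) (hUc : IsPreconnected U)
    (hγ : IsHolIntegralCurveOn E ξ γ U) {t₀ : ℂ} (ht₀ : t₀ ∈ U) (h : velocity E γ t₀ ≠ 0) :
    ∀ t ∈ U, velocity E γ t ≠ 0 := by
  intro t ht h0
  have h1 : γ t₀ = γ t := hγ.eqOn_const hξ hU hUc ht h0 ht₀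
  have h2 : ∀ x, x = γ t → ξ x = 0 := by
    rintro x rfl
    exact (hγ t ht).2.symm.trans h0
  exact h ((hγ t₀ ht₀).2.trans (h2 _ h1))

/-- An integral curve on a disc with values in a set where the flow exists for the time `ε`
extends to a disc whose radius is larger by `ε`. -/
theorem IsHolIntegralCurveOn.exists_extension_ball [T2Space X]
    {ξ : (x : X) → TangentSpace 𝓘(ℂ, E) x} (hξ : IsHolVectorField E ξ) {ε : ℝ} (hε : 0 < ε)
    {K : Set X} (hK : ∀ x ∈ K, HasFlowTime ξ ε x) {t₀ : ℂ} {R : ℝ} (hR : 0 < R) {δ : ℂ → X}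
    (hδ : IsHolIntegralCurveOn E ξ δ (ball t₀ R)) (hδK : ∀ t ∈ ball t₀ R, δ t ∈ K) :
    ∃ Γ : ℂ → X, IsHolIntegralCurveOn E ξ Γ (ball t₀ (ε + R)) ∧ Γ t₀ = δ t₀ := by
  have hex : ∀ t : ball t₀ R, ∃ c : ℂ → X, c t = δ t ∧ IsHolIntegralCurveOn E ξ c (ball (t : ℂ) ε) :=
    fun t => (hK _ (hδK t t.2)).exists_integralCurve t
  choose c hc0 hc using hex
  have : Nonempty (ball t₀ R) := ⟨⟨t₀, mem_ball_self hR⟩⟩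
  have hcδ : ∀ t : ball t₀ R, EqOn (c t) δ (ball (t : ℂ) ε ∩ ball t₀ R) := fun t =>
    ((hc t).mono inter_subset_left).eqOn hξ (isOpen_ball.inter isOpen_ball)
      ((convex_ball _ _).inter (convex_ball _ _)).isPreconnected (hδ.mono inter_subset_right)
      ⟨mem_ball_self hε, t.2⟩ (hc0 t)
  have hag : ∀ i j : ball t₀ R, EqOn (c i) (c j) (ball (i : ℂ) ε ∩ ball (j : ℂ) ε) := by
    rintro i j z ⟨hzi, hzj⟩
    have hij : dist (i : ℂ) j < 2 * ε := by
      rw [mem_ball] at hzi hzj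
      linarith [dist_triangle_left (i : ℂ) j z]
    -- If two of the small discs meet, the midpoint of their centres lies in both and, by convexity,
    -- in the original disc. There both curves agree with δ, so they agree on the whole overlap.
    set m := midpoint ℝ (i : ℂ) j
    have hmi : m ∈ ball (i : ℂ) ε := by
      rw [mem_ball, dist_midpoint_left]
      simp only [Real.norm_ofNat]
      linarith
    have hmj : m ∈ ball (j : ℂ) ε := by
      rw [mem_ball, dist_midpoint_right]
      simp only [Real.norm_ofNat]
      linarith
    have hmR : m ∈ ball t₀ R := (convex_ball t₀ R).midpoint_mem i.2 j.2
    exact ((hc i).mono inter_subset_left).eqOn hξ (isOpen_ball.inter isOpen_ball)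
      ((convex_ball _ _).inter (convex_ball _ _)).isPreconnected ((hc j).mono inter_subset_right)
      ⟨hmi, hmj⟩ ((hcδ i ⟨hmi, hmR⟩).trans (hcδ j ⟨hmj, hmR⟩).symm) ⟨hzi, hzj⟩
  obtain ⟨Γ, hΓ, hΓc⟩ := exists_glued_integralCurve (fun i : ball t₀ R => isOpen_ball) hc hag
  refine ⟨Γ, hΓ.mono ?_, ?_⟩
  · rw [← thickening_ball hε hR, thickening_eq_biUnion_ball, biUnion_eq_iUnion]
  · exact (hΓc ⟨t₀, mem_ball_self hR⟩ (mem_ball_self hε)).trans (hc0 _)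

/-- If all integral curves on discs about `t₀` starting at `x₀` stay in a fixed compact set, there
is an entire integral curve starting at `x₀`. -/
theorem exists_entire_integralCurve [CompleteSpace E] [T2Space X]
    {ξ : (x : X) → TangentSpace 𝓘(ℂ, E) x} (hξ : IsHolVectorField E ξ) {K : Set X}
    (hK : IsCompact K) {t₀ : ℂ} {x₀ : X} (hx₀ : x₀ ∈ K)
    (hstay : ∀ R > 0, ∀ δ : ℂ → X, IsHolIntegralCurveOn E ξ δ (ball t₀ R) → δ t₀ = x₀ →
      ∀ t ∈ ball t₀ R, δ t ∈ K) :
    ∃ Γ : ℂ → X, IsHolIntegralCurveOn E ξ Γ univ ∧ Γ t₀ = x₀ := by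
  obtain ⟨ε, hε, hflow⟩ := hK.exists_hasFlowTime hξ
  have hex : ∀ n : ℕ, ∃ δ : ℂ → X, IsHolIntegralCurveOn E ξ δ (ball t₀ ((n + 1) * ε)) ∧
      δ t₀ = x₀ := by
    intro n
    induction n with
    | zero =>
      obtain ⟨δ, h0, hδ⟩ := (hflow x₀ hx₀).exists_integralCurve t₀
      exact ⟨δ, by simpa using hδ, h0⟩
    | succ n ih =>
      obtain ⟨δ, hδ, h0⟩ := ih
      have hR : 0 < (n + 1) * ε := by positivity
      -- As the curve stays in `K`, the same gain ε is available at every stage.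
      obtain ⟨Γ, hΓ, hΓ0⟩ := hδ.exists_extension_ball hξ hε hflow hR (hstay _ hR δ hδ h0)
      refine ⟨Γ, ?_, hΓ0.trans h0⟩
      have : ((n + 1 : ℕ) + 1 : ℝ) * ε = ε + (n + 1) * ε := by push_cast; ring
      rwa [this]
  choose δ hδ hδ0 using hex
  have hmem : ∀ n : ℕ, t₀ ∈ ball t₀ ((n + 1) * ε) := fun n => mem_ball_self (by positivity)
  obtain ⟨Γ, hΓ, hΓδ⟩ := exists_glued_integralCurve (fun n : ℕ => isOpen_ball) hδ fun i j =>
    ((hδ i).mono inter_subset_left).eqOn hξ (isOpen_ball.inter isOpen_ball)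
      ((convex_ball _ _).inter (convex_ball _ _)).isPreconnected ((hδ j).mono inter_subset_right)
      ⟨hmem i, hmem j⟩ ((hδ0 i).trans (hδ0 j).symm)
  refine ⟨Γ, hΓ.mono fun t _ => ?_, (hΓδ 0 (hmem 0)).trans (hδ0 0)⟩
  obtain ⟨n, hn⟩ := exists_nat_gt (dist t t₀ / ε)
  rw [div_lt_iff₀ hε] at hn
  refine mem_iUnion.2 ⟨n, ?_⟩
  rw [mem_ball]
  nlinarith

end CoreFlow

end

/-! ### The theorem -/

theorem lemma2p3 {E : Type*} [NormedAddCommGroup E] [NormedSpace ℂ E] [FiniteDimensional ℂ E]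
    {X : Type*} [TopologicalSpace X] [T2Space X] [ChartedSpace E X]
    [IsManifold 𝓘(ℂ, E) ω X]
    (hX : IsPseudoconvexManifold E X)
    (ξ : (x : X) → TangentSpace 𝓘(ℂ, E) x) (hξ : IsHolVectorField E ξ)
    (U : Set ℂ) (hUo : IsOpen U) (hUc : IsConnected U)
    (γ : ℂ → X) (hγ : IsHolIntegralCurveOn E ξ γ U) :
    ((projVelocity E γ U ∩ coreSet E X).Nonempty →
      (∀ t ∈ U, velocity E γ t ≠ 0) ∧ projVelocity E γ U ⊆ coreSet E X) ∧
    (HasSmoothPSHExhaustion E X → projVelocity E γ U ⊆ coreSet E X →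
      IsCompact (closure (γ '' U)) ∧
      (∃ Γ : ℂ → X, IsHolIntegralCurveOn E ξ Γ Set.univ ∧ Set.EqOn γ Γ U) ∧
      (IsMaximalHolIntegralCurve E ξ γ U → U = Set.univ)) := by
  have : CompleteSpace E := FiniteDimensional.complete ℂ E
  have hUp := hUc.isPreconnected
  refine ⟨?_, fun hsm hcore => ?_⟩
  · rintro ⟨p, ⟨t₀, ht₀, hv, rfl⟩, hp⟩
    rw [mk_velocity_mem_coreSet_iff (hγ t₀ ht₀).1] at hp
    refine ⟨hγ.velocity_ne_zero hξ hUo hUp ht₀ hv, ?_⟩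
    rintro q ⟨t, ht, hvt, rfl⟩
    rw [mk_velocity_mem_coreSet_iff (hγ t ht).1]
    exact hγ.isCoreTime_of_isCoreTime hX hξ hUo hUp ht₀ hp t ht
  · obtain ⟨ρ, hρ, hρp, hρe⟩ := hsm
    obtain ⟨t₀, ht₀⟩ := hUc.nonempty
    have hρs : ∀ x, IsSmoothAround E ρ x := fun x =>
      ⟨Set.univ, isOpen_univ, Set.mem_univ x, hρ.contMDiffOn⟩
    have hcrit : ∀ t ∈ U, fderiv ℝ (ρ ∘ γ) t = 0 := by
      intro t ht
      -- A zero of γ' gives no point of the projectivized bundle, but there ∂ρ(0) = 0 is automatic.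
      by_cases hv : velocity E γ t = 0
      · rw [← del_velocity_eq_zero_iff (hρs (γ t)).mdifferentiableAt (hγ t ht).1, hv]
        simpa using del_smul E ρ (γ t) 0 0
      · exact (mk_velocity_mem_coreSet_iff (hγ t ht).1 hv).1 (hcore ⟨t, ht, hv, rfl⟩) ρ hρp
          (hρs _)
    have hsub : ∀ x, ρ x = ρ (γ t₀) → x ∈ closure {x | ρ x < ρ (γ t₀) + 1} := fun x hx =>
      subset_closure (show ρ x < ρ (γ t₀) + 1 by linarith)
    have hcompact : IsCompact (closure (γ '' U)) := by
      refine (hρe (ρ (γ t₀) + 1)).of_isClosed_subset isClosed_closure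
        (closure_minimal ?_ isClosed_closure)
      rintro _ ⟨t, ht, rfl⟩
      exact hsub _ (hγ.const_of_fderiv_comp_eq_zero hUo hUp hρ hcrit ht ht₀)
    have hext : ∃ Γ : ℂ → X, IsHolIntegralCurveOn E ξ Γ Set.univ ∧ Set.EqOn γ Γ U := by
      by_cases hv : velocity E γ t₀ = 0
      · exact ⟨fun _ => γ t₀, isHolIntegralCurveOn_const ((hγ t₀ ht₀).2.symm.trans hv) _,
          hγ.eqOn_const hξ hUo hUp ht₀ hv⟩
      have hstay : ∀ R > 0, ∀ δ : ℂ → X, IsHolIntegralCurveOn E ξ δ (Metric.ball t₀ R) →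
          δ t₀ = γ t₀ → ∀ t ∈ Metric.ball t₀ R, δ t ∈ closure {x | ρ x < ρ (γ t₀) + 1} := by
        intro R hR δ hδ hδ0 t ht
        refine hsub _ ?_
        have htR : t₀ ∈ Metric.ball t₀ R := Metric.mem_ball_self hR
        have hpre := (convex_ball t₀ R).isPreconnected
        have hcore₀ : IsCoreTime E γ t₀ :=
          (mk_velocity_mem_coreSet_iff (hγ t₀ ht₀).1 hv).1 (hcore ⟨t₀, ht₀, hv, rfl⟩)
        -- The germs of δ and γ at `t₀` coincide, so the core condition passes to δ; invariance then
        -- spreads it over the whole disc, also outside `U`, and makes ρ ∘ δ constant.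
        have hcoreδ : IsCoreTime E δ t₀ := by
          intro φ hφ hφs
          have hUR := hUo.inter (Metric.isOpen_ball (x := t₀) (ε := R))
          have heq := (hδ.mono Set.inter_subset_right).eventuallyEq hξ hUR
            (hγ.mono Set.inter_subset_left) ⟨ht₀, htR⟩ hδ0
          rw [(heq.fun_comp φ).fderiv_eq]
          exact hcore₀ φ hφ (hδ0 ▸ hφs)
        rw [← hδ0]
        exact hδ.const_of_fderiv_comp_eq_zero Metric.isOpen_ball hpre hρ
          (fun z hz => hδ.isCoreTime_of_isCoreTime hX hξ Metric.isOpen_ball hpre htR hcoreδ z hz ρ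
            hρp (hρs _)) ht htR
      obtain ⟨Γ, hΓ, hΓ0⟩ := exists_entire_integralCurve hξ (hρe (ρ (γ t₀) + 1)) (t₀ := t₀)
        (hsub (γ t₀) rfl) hstay
      exact ⟨Γ, hΓ, hγ.eqOn hξ hUo hUp (hΓ.mono (Set.subset_univ U)) ht₀ hΓ0.symm⟩
    refine ⟨hcompact, hext, fun hmax => ?_⟩
    obtain ⟨Γ, hΓ, hEq⟩ := hext
    exact (hmax.2 Set.univ Γ isOpen_univ isConnected_univ (Set.subset_univ U) hΓ hEq).symm
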